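/- **Setting.** Let $m\ge 2$ clients be given. Client $i\in[m]$ has a sample space with a data distribution $\mathcal D_i$ and a loss $\ell_i(x;z)$, $x\in\mathbb R^d$, which is differentiable in $x$ and integrable in $z$ under $\mathcal D_i$. Put $F_i(x)=\mathbb E_{z\sim\mathcal D_i}[\ell_i(x;z)]$ and $F=\frac1m\sum_{i=1}^m F_i$; gradients are with respect to $x$. **FedPBC.** Fix the number of rounds $T\ge1$, the number of local steps $s\ge 1$, the learning rate $\eta>0$ and an initial point $x^0\in\mathbb R^d$. The server and all clients start at $x^0$, so $x_i^0=x^0$. In round $t=0,\dots,T-1$ each client $i$, using one stochastic sample $\xi_i^t$, sets $x_i^{(t,0)}=x_i^t$ and $$x_i^{(t,k+1)}=x_i^{(t,k)}-\eta\nabla\ell_i(x_i^{(t,k)};\xi_i^t),\quad k=0,\dots,s-1,\qquad x_i^{t\star}=x_i^{(t,s)}.$$ Let $\mathcal A^t\subseteq[m]$ be the random set of clients with an active uplink in round $t$. The server sets $x^{t+1}=\frac1{|\mathcal A^t|}\sum_{i\in\mathcal A^t}x_i^{t\star}$ if $\mathcal A^t\ne\emptyset$ and $x^{t+1}=x^t$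 otherwise; then $x_i^{t+1}=x^{t+1}$ for $i\in\mathcal A^t$ and $x_i^{t+1}=x_i^{t\star}$ for $i\notin\mathcal A^t$. Put $\bar x^t=\frac1m\sum_{i=1}^m x_i^t$. Let $\mathcal F^t$ be the $\sigma$-algebra generated by all $\xi_i^r$ and $\mathcal A^r$ with $r<t$. For each $t<T$, $\mathcal A^t$ is independent of $\mathcal F^t$ and $(\xi_i^t)_{i\in[m]}$ jointly; its distribution may depend on $t$ and is otherwise arbitrary. **Constants.** Let $W^{(t)}$ be the $m\times m$ matrix with $W^{(t)}_{ij}=1/|\mathcal A^t|$ if $i,j\in\mathcal A^t$, $W^{(t)}_{ii}=1$ if $i\notin\mathcal A^t$, and $W^{(t)}_{ij}=0$ otherwise. Let $\rho=\max_{0\le t\le T-1}\lambda_2\big(\mathbb E[(W^{(t)})^2]\big)$, where $\lambda_2$ is the second largest eigenvalue, counted with multiplicity. For $L_1,\dots,L_m\ge0$ put $L=\max_i L_i$ and $$\kappa=\max_{i}\frac{(1+\eta L_i)^s-1-s\eta L_i}{\binom s2(\eta L_i)^2},$$ with $\kappa=0$ if $s=1$; clients with $L_i=0$ are left out of this maximum.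 **Theorem.** Let $\sigma,\beta,\zeta\ge 0$ and $F^*\in\mathbb R$. Assume: 1. (Smoothness) $\|\nabla\ell_i(x;z)-\nabla\ell_i(y;z)\|\le L_i\|x-y\|$ for all $i$, $x$, $y$, $z$, and $L\ge1$. 2. (Unbiasedness and bounded variance) For all $t<T$ and $i$, almost surely $\mathbb E[\nabla\ell_i(x_i^t;\xi_i^t)\mid\mathcal F^t]=\nabla F_i(x_i^t)$, and for every $x\in\mathbb R^d$, almost surely $\mathbb E[\|\nabla\ell_i(x;\xi_i^t)-\nabla F_i(x)\|^2\mid\mathcal F^t]\le\sigma^2$. 3. (Lower bound) $F(x)\ge F^*$ for all $x$. 4. (Bounded dissimilarity) $\frac1m\sum_{i=1}^m\|\nabla F_i(x)-\nabla F(x)\|^2\le\beta^2\|\nabla F(x)\|^2+\zeta^2$ for all $x$. 5. (Learning rate) $0<\eta\le\dfrac{1-\sqrt\rho}{108\,L^2s^3(\beta^2+1)(1+\kappa^2L^2)}$. Then $\mathbb E\|\nabla F(\bar x^t)\|^2<\infty$ for all $t<T$, and $$\frac1T\sum_{t=0}^{T-1}\mathbb E\big[\|\nabla F(\bar x^t)\|^2\big]\le\frac{6\,(F(\bar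 x^0)-F^*)}{\eta sT}+54\,\eta sL\Big(\kappa^2L^2+1+\frac1{1-\sqrt\rho}\Big)(\sigma^2+\zeta^2).$$ -/

import Mathlib

open MeasureTheory ProbabilityTheory
open scoped NNReal Gradient

namespace FedPBC

noncomputable section

/-- Local objective `F_i(x) = E_{z ∼ D}[ℓ(x; z)]`. -/
def localObjective {d : ℕ} {Z : Type*} [MeasurableSpace Z]
    (ℓ : EuclideanSpace ℝ (Fin d) → Z → ℝ) (D : Measure Z)
    (x : EuclideanSpace ℝ (Fin d)) : ℝ :=
  ∫ z, ℓ x z ∂D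

/-- Global objective `F = (1/m) ∑ i, F_i`. -/
def globalObjective {m d : ℕ} {Ξ : Fin m → Type*} [∀ i, MeasurableSpace (Ξ i)]
    (ℓ : (i : Fin m) → EuclideanSpace ℝ (Fin d) → Ξ i → ℝ)
    (D : (i : Fin m) → Measure (Ξ i)) (x : EuclideanSpace ℝ (Fin d)) : ℝ :=
  (1 / (m : ℝ)) * ∑ i, localObjective (ℓ i) (D i) x

/-- The stochastic gradient `∇ℓ(x; z)` with respect to the model `x`. -/
def stochGrad {d : ℕ} {Z : Type*} (ℓ : EuclideanSpace ℝ (Fin d) → Z → ℝ)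
    (z : Z) (x : EuclideanSpace ℝ (Fin d)) : EuclideanSpace ℝ (Fin d) :=
  ∇ (fun y => ℓ y z) x

/-- `k` local gradient steps of size `η` with the gradient field `g`, started at `x`. -/
def localSteps {E : Type*} [AddCommGroup E] [Module ℝ E]
    (g : E → E) (η : ℝ) (x : E) : ℕ → E
  | 0 => x
  | k + 1 => localSteps g η x k - η • g (localSteps g η x k)

/-- One round of FedPBC, acting on (server model, client models). Every client performs `s`
local steps; the server averages the results of the clients in `S` (the active uplinks), or keeps
its model if `S` is empty; the clients in `S` receive the new server model at the end of the
round, while the others keep their own local result. -/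
def round {m : ℕ} {E : Type*} [AddCommGroup E] [Module ℝ E]
    (g : Fin m → E → E) (S : Finset (Fin m)) (η : ℝ) (s : ℕ)
    (p : E × (Fin m → E)) : E × (Fin m → E) :=
  let star : Fin m → E := fun i => localSteps (g i) η (p.2 i) s
  let server : E := if S.Nonempty then (1 / (S.card : ℝ)) • ∑ i ∈ S, star i else p.1
  (server, fun i => if i ∈ S then server else star i)

/-- The FedPBC state (server model, client models) at the start of round `t`, along one
realization: `g t i` is the gradient field that client `i` uses throughout round `t` and `S t` the
set of active uplinks in round `t`. -/
def state {m : ℕ} {E : Type*} [AddCommGroup E] [Module ℝ E]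
    (g : ℕ → Fin m → E → E) (S : ℕ → Finset (Fin m)) (η : ℝ) (s : ℕ) (x₀ : E) :
    ℕ → E × (Fin m → E)
  | 0 => (x₀, fun _ => x₀)
  | t + 1 => round (g t) (S t) η s (state g S η s x₀ t)

/-- The client model `x_i^t` as a random variable. In round `t` client `i` uses the single sample
`ξ i t` in all its local steps. -/
def clientModel {m d : ℕ} {Ω : Type*} {Ξ : Fin m → Type*}
    (ℓ : (i : Fin m) → EuclideanSpace ℝ (Fin d) → Ξ i → ℝ)
    (ξ : (i : Fin m) → ℕ → Ω → Ξ i) (A : ℕ → Ω → Finset (Fin m))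
    (η : ℝ) (s : ℕ) (x₀ : EuclideanSpace ℝ (Fin d)) (t : ℕ) (i : Fin m) (ω : Ω) :
    EuclideanSpace ℝ (Fin d) :=
  (state (fun r j => stochGrad (ℓ j) (ξ j r ω)) (fun r => A r ω) η s x₀ t).2 i

/-- The average client model `x̄^t = (1/m) ∑ i, x_i^t`. -/
def avgModel {m d : ℕ} {Ω : Type*} {Ξ : Fin m → Type*}
    (ℓ : (i : Fin m) → EuclideanSpace ℝ (Fin d) → Ξ i → ℝ)
    (ξ : (i : Fin m) → ℕ → Ω → Ξ i) (A : ℕ → Ω → Finset (Fin m))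
    (η : ℝ) (s : ℕ) (x₀ : EuclideanSpace ℝ (Fin d)) (t : ℕ) (ω : Ω) :
    EuclideanSpace ℝ (Fin d) :=
  (1 / (m : ℝ)) • ∑ i, clientModel ℓ ξ A η s x₀ t i ω

/-- The σ-algebra generated by the samples of round `t`. -/
abbrev sampleSigma {m : ℕ} {Ω : Type*} {Ξ : Fin m → Type*} [∀ i, MeasurableSpace (Ξ i)]
    (ξ : (i : Fin m) → ℕ → Ω → Ξ i) (t : ℕ) : MeasurableSpace Ω :=
  ⨆ i, MeasurableSpace.comap (ξ i t) inferInstance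

/-- The σ-algebra generated by the set of active uplinks of round `t`. -/
abbrev linkSigma {m : ℕ} {Ω : Type*} (A : ℕ → Ω → Finset (Fin m)) (t : ℕ) : MeasurableSpace Ω :=
  MeasurableSpace.comap (A t) ⊤

/-- `𝓕^t`: the σ-algebra generated by all the randomness (samples and uplinks) of the rounds
before round `t`. -/
abbrev history {m : ℕ} {Ω : Type*} {Ξ : Fin m → Type*} [∀ i, MeasurableSpace (Ξ i)]
    (ξ : (i : Fin m) → ℕ → Ω → Ξ i) (A : ℕ → Ω → Finset (Fin m)) (t : ℕ) :
    MeasurableSpace Ω :=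
  ⨆ r : Fin t, sampleSigma ξ r ⊔ linkSigma A r

/-- The implicit gossip matrix of a round whose set of active uplinks is `S`. -/
def gossipMatrix {m : ℕ} (S : Finset (Fin m)) : Matrix (Fin m) (Fin m) ℝ :=
  Matrix.of fun i j =>
    if i ∈ S ∧ j ∈ S then 1 / (S.card : ℝ) else if i = j then 1 else 0

/-- `M^{(t)} = E[(W^{(t)})²]`, entrywise expectation. -/
def meanSqGossip {m : ℕ} {Ω : Type*} [MeasurableSpace Ω] (P : Measure Ω)
    (A : ℕ → Ω → Finset (Fin m)) (t : ℕ) : Matrix (Fin m) (Fin m) ℝ :=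
  Matrix.of fun i j => ∫ ω, (gossipMatrix (A t ω) ^ 2) i j ∂P

theorem gossipMatrix_isHermitian {m : ℕ} (S : Finset (Fin m)) :
    (gossipMatrix S).IsHermitian := by
  ext i j
  simp only [Matrix.conjTranspose_apply, gossipMatrix, Matrix.of_apply, star_trivial,
    and_comm, eq_comm]

theorem meanSqGossip_isHermitian {m : ℕ} {Ω : Type*} [MeasurableSpace Ω] (P : Measure Ω)
    (A : ℕ → Ω → Finset (Fin m)) (t : ℕ) : (meanSqGossip P A t).IsHermitian := by
  ext i j
  simp only [Matrix.conjTranspose_apply, meanSqGossip, Matrix.of_apply, star_trivial]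
  refine integral_congr_ae (Filter.Eventually.of_forall fun ω => ?_)
  have h := ((gossipMatrix_isHermitian (A t ω)).pow 2).apply i j
  simpa using h

/-- `λ₂`: the second largest eigenvalue, counted with multiplicity, of a real symmetric matrix of
size at least two. (`eigenvalues₀` lists the eigenvalues in decreasing order.) -/
def lambda2 {m : ℕ} (hm : 2 ≤ m) {M : Matrix (Fin m) (Fin m) ℝ} (hM : M.IsHermitian) : ℝ :=
  hM.eigenvalues₀ ⟨1, by rw [Fintype.card_fin]; omega⟩

/-- `ρ = max_t λ₂(M^{(t)})`, the maximum over the rounds `t = 0, …, T - 1`. -/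
def rho {m : ℕ} (hm : 2 ≤ m) {Ω : Type*} [MeasurableSpace Ω] (P : Measure Ω)
    (A : ℕ → Ω → Finset (Fin m)) (T : ℕ) : ℝ :=
  ⨆ t : Fin T, lambda2 hm (meanSqGossip_isHermitian P A t)

/-- `L = max_i L_i`. -/
def maxLip {m : ℕ} (L : Fin m → ℝ≥0) : ℝ := ⨆ i, (L i : ℝ)

/-- `κ = max_i ((1 + η L_i)^s - 1 - s η L_i) / (binom(s,2) (η L_i)²)`. For `s = 1` this is `0`. If
`s ≥ 2`, a client with `L_i = 0` contributes `0`, which does not affect the maximum as soon as some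
`L_j` is positive. -/
def kappa {m : ℕ} (L : Fin m → ℝ≥0) (η : ℝ) (s : ℕ) : ℝ :=
  ⨆ i, ((1 + η * L i) ^ s - 1 - s * η * L i) / ((s.choose 2 : ℝ) * (η * L i) ^ 2)

end

end FedPBC

/-! Communication in a round is multiplication by the symmetric, row-stochastic matrix W of the
active set. It therefore preserves the average of the models, and the averaged model obeys x̄⁺ = x̄
− η · mean G, where G_i is the sum of the gradients client i used in the round. This is a perturbed
gradient descent for F, whatever the law of the active sets.

A client reuses one sample during a round, so unbiasedness is available only for its first gradient
g_i. The remaining ones are compared with g_i pathwise: the Lipschitz bound for each sample gives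
‖G_i − s g_i‖ ≤ δ‖g_i‖ with δ = κ·binom(s,2)·η·L (`norm_roundGrad_sub_le`). Hence every error term
is a multiple of the mean of ‖g_i‖².

With r = √ρ, three inequalities per round link the expected squared gradient a at x̄, the expected
spread v of the models and the second moment u of the g_i. `integral_avgSq_le` bounds u by noise,
dissimilarity, v and a. `integral_spread_succ_le`, with a Young inequality, gives v⁺ ≤ r v +
η²(s+δ)² u/(1−r): independence of the active set lets E[W²] act on the deviations from the mean,
which are orthogonal to the all-ones vector and so see only λ₂. `integral_descent` bounds the
decrease of F. Summed over the rounds these form a linear system, which the learning rate condition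
closes (`sum_gradient_bound`).

The hypotheses leave some analysis to do: gradients of the F_i and square integrability of the
iterates must be derived, and the variance bound, given at fixed points, must be carried to the
random models (`lintegral_comp_le_of_condExp_le`). -/

namespace FedPBC

/-! ### Drift of local gradient steps -/

section LocalSteps

variable {E : Type*} [NormedAddCommGroup E] [NormedSpace ℝ E]

/-- The sum of the gradients used along `n` local steps. -/
noncomputable def pathGrad (g : E → E) (η : ℝ) (x : E) (n : ℕ) : E :=
  ∑ k ∈ Finset.range n, g (localSteps g η x k)

theorem localSteps_eq_sub_pathGrad (g : E → E) (η : ℝ) (x : E) (n : ℕ) :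
    localSteps g η x n = x - η • pathGrad g η x n := by
  induction n with
  | zero => simp [localSteps, pathGrad]
  | succ n ih =>
    rw [pathGrad, Finset.sum_range_succ, smul_add, ← sub_sub, ← pathGrad, ← ih]
    rfl

/-- Since ‖g y‖ ≤ ‖g x‖ + K‖y − x‖, one step multiplies K‖y − x‖ by at most 1 + ηK and adds at most
ηK‖g x‖. Keeping the factor K on the left avoids a division that would fail for K = 0. -/
theorem mul_norm_localSteps_sub_le {g : E → E} {K : ℝ≥0} (hg : LipschitzWith K g) {η : ℝ}
    (hη : 0 ≤ η) (x : E) (n : ℕ) :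
    K * ‖localSteps g η x n - x‖ ≤ ((1 + η * K) ^ n - 1) * ‖g x‖ := by
  induction n with
  | zero => simp [localSteps]
  | succ n ih =>
    set y := localSteps g η x n with hy
    have hK : (0 : ℝ) ≤ K := K.2
    have h1 : ‖g y‖ ≤ ‖g x‖ + K * ‖y - x‖ := by
      have := hg.norm_sub_le y x
      linarith [norm_le_norm_add_norm_sub (g x) (g y), norm_sub_rev (g x) (g y)]
    have h2 : ‖localSteps g η x (n + 1) - x‖ ≤ ‖y - x‖ + η * ‖g y‖ := by
      have : localSteps g η x (n + 1) - x = (y - x) - η • g y := by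
        simp only [localSteps, ← hy]; abel
      rw [this]
      refine (norm_sub_le _ _).trans ?_
      rw [norm_smul, Real.norm_of_nonneg hη]
    calc K * ‖localSteps g η x (n + 1) - x‖
        ≤ K * (‖y - x‖ + η * (‖g x‖ + K * ‖y - x‖)) := by gcongr; exact h2.trans (by gcongr)
      _ = (1 + η * K) * (K * ‖y - x‖) + η * K * ‖g x‖ := by ring
      _ ≤ (1 + η * K) * (((1 + η * K) ^ n - 1) * ‖g x‖) + η * K * ‖g x‖ := by gcongr
      _ = _ := by ring

theorem norm_pathGrad_sub_le {g : E → E} {K : ℝ≥0} (hg : LipschitzWith K g) {η : ℝ}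
    (hη : 0 ≤ η) (x : E) (n : ℕ) :
    ‖pathGrad g η x n - (n : ℝ) • g x‖
      ≤ (∑ k ∈ Finset.range n, ((1 + η * K) ^ k - 1)) * ‖g x‖ := by
  have : pathGrad g η x n - (n : ℝ) • g x
      = ∑ k ∈ Finset.range n, (g (localSteps g η x k) - g x) := by
    simp [pathGrad, Finset.sum_sub_distrib, Nat.cast_smul_eq_nsmul]
  rw [this, Finset.sum_mul]
  refine (norm_sum_le _ _).trans (Finset.sum_le_sum fun k _ => ?_)
  exact (hg.norm_sub_le _ _).trans (mul_norm_localSteps_sub_le hg hη x k)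

end LocalSteps

/-! ### The constants L and κ -/

section Constants

/-- A geometric sum in product form, valid also at a = 0. For a = ηL_i the right side is the
numerator in `kappa`. -/
theorem mul_sum_one_add_pow_sub_one (a : ℝ) (n : ℕ) :
    a * ∑ k ∈ Finset.range n, ((1 + a) ^ k - 1) = (1 + a) ^ n - 1 - n * a := by
  induction n with
  | zero => simp
  | succ n ih => rw [Finset.sum_range_succ, mul_add, ih]; push_cast; ring

theorem sum_one_add_pow_sub_one_nonneg {a : ℝ} (ha : 0 ≤ a) (n : ℕ) :
    0 ≤ ∑ k ∈ Finset.range n, ((1 + a) ^ k - 1) :=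
  Finset.sum_nonneg fun _ _ => sub_nonneg.2 (one_le_pow₀ (by linarith))

variable {m : ℕ} (L : Fin m → ℝ≥0)

theorem le_maxLip (i : Fin m) : (L i : ℝ) ≤ maxLip L :=
  le_ciSup (f := fun i => (L i : ℝ)) (Set.finite_range _).bddAbove i

theorem le_kappa (η : ℝ) (s : ℕ) (i : Fin m) :
    ((1 + η * L i) ^ s - 1 - s * η * L i) / ((s.choose 2 : ℝ) * (η * L i) ^ 2) ≤ kappa L η s :=
  le_ciSup (f := fun i => ((1 + η * L i) ^ s - 1 - s * η * L i) /
    ((s.choose 2 : ℝ) * (η * L i) ^ 2)) (Set.finite_range _).bddAbove i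

theorem kappa_nonneg {η : ℝ} (hη : 0 ≤ η) (s : ℕ) : 0 ≤ kappa L η s := by
  refine Real.iSup_nonneg fun i => div_nonneg ?_ (by positivity)
  have hL : (0 : ℝ) ≤ L i := (L i).2
  rw [mul_assoc, ← mul_sum_one_add_pow_sub_one]
  exact mul_nonneg (by positivity) (sum_one_add_pow_sub_one_nonneg (by positivity) s)

/-- One factor ηL_i of the denominator in `kappa` cancels against the geometric sum identity. When s
< 2 or L_i = 0 that denominator vanishes, but then every summand is zero. -/
theorem sum_one_add_pow_sub_one_le_kappa {η : ℝ} (hη : 0 < η) (s : ℕ) (i : Fin m) :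
    ∑ k ∈ Finset.range s, ((1 + η * L i) ^ k - 1)
      ≤ kappa L η s * s.choose 2 * η * maxLip L := by
  have hκ := kappa_nonneg L hη.le s
  have hM : 0 ≤ maxLip L := (L i).2.trans (le_maxLip L i)
  have hrhs : 0 ≤ kappa L η s * s.choose 2 * η * maxLip L := by positivity
  rcases Nat.lt_or_ge s 2 with hs | hs
  · interval_cases s <;> simp
  rcases eq_or_lt_of_le (L i).2 with h0 | h0
  · have h0 : L i = 0 := NNReal.coe_eq_zero.1 h0.symm
    simpa [h0] using hrhs
  have h0 : (0 : ℝ) < L i := h0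
  have hc : (0 : ℝ) < s.choose 2 := by exact_mod_cast Nat.choose_pos hs
  have h := le_kappa L η s i
  rw [div_le_iff₀ (by positivity), mul_assoc (s : ℝ), ← mul_sum_one_add_pow_sub_one] at h
  have h2 : ∑ k ∈ Finset.range s, ((1 + η * L i) ^ k - 1)
      ≤ kappa L η s * s.choose 2 * η * L i := by
    refine le_of_mul_le_mul_left (h.trans_eq ?_) (mul_pos hη h0)
    ring
  exact h2.trans (by gcongr; exact le_maxLip L i)

end Constants

/-! ### The gossip matrix -/

section Gossip

variable {m : ℕ}

theorem sum_gossipMatrix (S : Finset (Fin m)) (i : Fin m) :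
    ∑ j, gossipMatrix S i j = 1 := by
  by_cases hi : i ∈ S
  · have : ∀ j, gossipMatrix S i j = if j ∈ S then 1 / (S.card : ℝ) else 0 := by
      intro j
      by_cases hj : j ∈ S
      · simp [gossipMatrix, hi, hj]
      · have : i ≠ j := fun h => hj (h ▸ hi)
        simp [gossipMatrix, hj, this]
    have hS : (S.card : ℝ) ≠ 0 := by
      exact_mod_cast Finset.card_ne_zero_of_mem hi
    simp [this, hS]
  · simp [gossipMatrix, hi]

theorem gossipMatrix_symm (S : Finset (Fin m)) (i j : Fin m) :
    gossipMatrix S i j = gossipMatrix S j i := by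
  simpa using (gossipMatrix_isHermitian S).apply j i

theorem sum_gossipMatrix_sq (S : Finset (Fin m)) (i : Fin m) :
    ∑ j, (gossipMatrix S ^ 2) i j = 1 := by
  simp only [pow_two, Matrix.mul_apply]
  rw [Finset.sum_comm]
  simp only [← Finset.mul_sum, sum_gossipMatrix, mul_one]

/-- One round acts on the locally updated models as the gossip matrix. -/
theorem round_snd {E : Type*} [AddCommGroup E] [Module ℝ E] (g : Fin m → E → E)
    (S : Finset (Fin m)) (η : ℝ) (s : ℕ) (p : E × (Fin m → E)) (i : Fin m) :
    (round g S η s p).2 i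
      = ∑ j, gossipMatrix S i j • localSteps (g j) η (p.2 j) s := by
  by_cases hi : i ∈ S
  · have : ∀ j, gossipMatrix S i j = if j ∈ S then 1 / (S.card : ℝ) else 0 := by
      intro j
      by_cases hj : j ∈ S
      · simp [gossipMatrix, hi, hj]
      · have : i ≠ j := fun h => hj (h ▸ hi)
        simp [gossipMatrix, hj, this]
    have hS : S.Nonempty := ⟨i, hi⟩
    simp [this, round, hi, hS, Finset.smul_sum, ite_smul]
  · simp [round, gossipMatrix, hi, ite_smul]

variable {E : Type*} [NormedAddCommGroup E] [InnerProductSpace ℝ E]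

/-- The average of a finite family of vectors. -/
noncomputable def mean (x : Fin m → E) : E := (1 / (m : ℝ)) • ∑ i, x i

/-- Symmetry turns unit row sums into unit column sums, so communication does not move the average.
-/
theorem mean_gossip (S : Finset (Fin m)) (y : Fin m → E) :
    mean (fun i => ∑ j, gossipMatrix S i j • y j) = mean y := by
  unfold mean
  rw [Finset.sum_comm]
  simp only [← Finset.sum_smul]
  congr 1
  refine Finset.sum_congr rfl fun j _ => ?_
  simp only [gossipMatrix_symm S _ j, sum_gossipMatrix, one_smul]

/-- By symmetry WᵀW = W². In this form the random matrix enters linearly, so that its expectation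
can be taken entry by entry. -/
theorem sum_norm_sq_gossip (S : Finset (Fin m)) (y : Fin m → E) :
    ∑ i, ‖∑ j, gossipMatrix S i j • y j‖ ^ 2
      = ∑ j, ∑ k, (gossipMatrix S ^ 2) j k * inner ℝ (y j) (y k) := by
  simp only [← real_inner_self_eq_norm_sq, sum_inner, inner_sum, real_inner_smul_left,
    real_inner_smul_right, pow_two (gossipMatrix S), Matrix.mul_apply, Finset.sum_mul]
  rw [Finset.sum_comm]
  refine Finset.sum_congr rfl fun j _ => ?_
  rw [Finset.sum_comm]
  refine Finset.sum_congr rfl fun k _ => Finset.sum_congr rfl fun i _ => ?_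
  rw [gossipMatrix_symm S j i, real_inner_comm]
  ring_nf

theorem gossip_sub_mean (S : Finset (Fin m)) (y : Fin m → E) (i : Fin m) :
    (∑ j, gossipMatrix S i j • y j) - mean y
      = ∑ j, gossipMatrix S i j • (y j - mean y) := by
  simp [smul_sub, Finset.sum_sub_distrib, ← Finset.sum_smul, sum_gossipMatrix]

end Gossip

/-! ### The second eigenvalue on vectors of zero sum -/

section Spectral

variable {m : ℕ}

/-- A symmetric matrix that fixes the all-ones vector and whose second eigenvalue is less than one
is bounded by its second eigenvalue on the vectors with vanishing sum. -/
theorem dotProduct_mulVec_le_lambda2 (hm : 2 ≤ m) {M : Matrix (Fin m) (Fin m) ℝ}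
    (hM : M.IsHermitian) (h1 : ∀ i, ∑ j, M i j = 1) (hlt : lambda2 hm hM < 1)
    (v : Fin m → ℝ) (hv : ∑ i, v i = 0) :
    ∑ i, ∑ j, M i j * (v i * v j) ≤ lambda2 hm hM * ∑ i, v i ^ 2 := by
  set hT := Matrix.isSymmetric_toEuclideanLin_iff.mpr hM
  set b := hT.eigenvectorBasis finrank_euclideanSpace
  set e₁ : Fin (Fintype.card (Fin m)) := ⟨1, by rw [Fintype.card_fin]; omega⟩
  set e₀ : Fin (Fintype.card (Fin m)) := ⟨0, by rw [Fintype.card_fin]; omega⟩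
  have hrepr : ∀ (x : EuclideanSpace ℝ (Fin m)) i,
      b.repr (Matrix.toEuclideanLin M x) i = hM.eigenvalues₀ i * b.repr x i :=
    fun x i => hT.eigenvectorBasis_apply_self_apply finrank_euclideanSpace x i
  have hle : ∀ i, i ≠ e₀ → hM.eigenvalues₀ i ≤ lambda2 hm hM := by
    intro i hi
    refine hM.eigenvalues₀_antitone (Fin.mk_le_of_le_val ?_)
    exact Nat.one_le_iff_ne_zero.2 fun h => hi (Fin.ext h)
  set u : EuclideanSpace ℝ (Fin m) := WithLp.toLp 2 fun _ => 1 with hu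
  set w : EuclideanSpace ℝ (Fin m) := WithLp.toLp 2 v with hw
  have hTu : Matrix.toEuclideanLin M u = u := by
    ext i
    simp [hu, Matrix.mulVec, dotProduct, h1]
  -- The all-ones vector is fixed, while all eigenvalues but the top one are below 1. It is thus a
  -- multiple of the top eigenvector, and a zero-sum vector has no top component.
  have hcu : ∀ i, i ≠ e₀ → b.repr u i = 0 := by
    intro i hi
    have h := hrepr u i
    rw [hTu] at h
    have : (1 - hM.eigenvalues₀ i) * b.repr u i = 0 := by linarith
    exact (mul_eq_zero.1 this).resolve_left (by linarith [hle i hi])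
  have hcu0 : b.repr u e₀ ≠ 0 := by
    intro h
    have hz : b.repr u = 0 := by
      ext i
      by_cases hi : i = e₀
      · rw [hi, h]; rfl
      · rw [hcu i hi]; rfl
    have hu0 : u = 0 := by simpa using hz
    have := congrArg (fun x : EuclideanSpace ℝ (Fin m) => x ⟨0, by omega⟩) hu0
    simp [hu] at this
  have hw0 : b.repr w e₀ = 0 := by
    have h : inner ℝ u w = 0 := by
      simp [hu, hw, PiLp.inner_apply, hv]
    rw [← b.repr.inner_map_map, PiLp.inner_apply,
      Finset.sum_eq_single e₀ (fun i _ hi => by simp [hcu i hi]) (by simp)] at h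
    simpa [hcu0] using h
  have hquad : ∑ i, ∑ j, M i j * (v i * v j) = ∑ i, hM.eigenvalues₀ i * b.repr w i ^ 2 := by
    have : inner ℝ w (Matrix.toEuclideanLin M w) = ∑ i, ∑ j, M i j * (v i * v j) := by
      simp only [PiLp.inner_apply, hw, Matrix.toLpLin_apply, Matrix.mulVec, dotProduct]
      refine Finset.sum_congr rfl fun i _ => ?_
      simp only [RCLike.inner_apply, conj_trivial, Finset.sum_mul]
      exact Finset.sum_congr rfl fun j _ => by ring
    rw [← this, ← b.repr.inner_map_map, PiLp.inner_apply]
    refine Finset.sum_congr rfl fun i _ => ?_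
    rw [hrepr]
    simp only [RCLike.inner_apply, conj_trivial]
    ring
  have hnorm : ∑ i, v i ^ 2 = ∑ i, b.repr w i ^ 2 := by
    have h := b.repr.norm_map w
    have h2 : ‖b.repr w‖ ^ 2 = ‖w‖ ^ 2 := by rw [h]
    rw [EuclideanSpace.norm_sq_eq, EuclideanSpace.norm_sq_eq] at h2
    simpa only [Real.norm_eq_abs, sq_abs] using h2.symm
  rw [hquad, hnorm, Finset.mul_sum]
  refine Finset.sum_le_sum fun i _ => ?_
  by_cases hi : i = e₀
  · simp [hi, hw0]
  · exact mul_le_mul_of_nonneg_right (hle i hi) (sq_nonneg _)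

/-- The inner product is a sum over coordinates, so the scalar bound applies to each coordinate
separately. -/
theorem sum_inner_le_lambda2 (hm : 2 ≤ m) {M : Matrix (Fin m) (Fin m) ℝ}
    (hM : M.IsHermitian) (h1 : ∀ i, ∑ j, M i j = 1) (hlt : lambda2 hm hM < 1)
    {d : ℕ} (y : Fin m → EuclideanSpace ℝ (Fin d)) (hy : ∑ i, y i = 0) :
    ∑ i, ∑ j, M i j * inner ℝ (y i) (y j) ≤ lambda2 hm hM * ∑ i, ‖y i‖ ^ 2 := by
  have h : ∀ k, ∑ i, ∑ j, M i j * (y i k * y j k) ≤ lambda2 hm hM * ∑ i, y i k ^ 2 := by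
    intro k
    refine dotProduct_mulVec_le_lambda2 hm hM h1 hlt (fun i => y i k) ?_
    have := congrArg (fun w : EuclideanSpace ℝ (Fin d) => w k) hy
    simpa using this
  calc ∑ i, ∑ j, M i j * inner ℝ (y i) (y j)
      = ∑ i, ∑ j, ∑ k, M i j * (y i k * y j k) := by
        simp [PiLp.inner_apply, Finset.mul_sum, mul_comm]
    _ = ∑ i, ∑ k, ∑ j, M i j * (y i k * y j k) :=
        Finset.sum_congr rfl fun i _ => Finset.sum_comm
    _ = ∑ k, ∑ i, ∑ j, M i j * (y i k * y j k) := Finset.sum_comm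
    _ ≤ ∑ k, lambda2 hm hM * ∑ i, y i k ^ 2 := Finset.sum_le_sum fun k _ => h k
    _ = lambda2 hm hM * ∑ i, ‖y i‖ ^ 2 := by
        rw [← Finset.mul_sum, Finset.sum_comm]
        simp [EuclideanSpace.norm_sq_eq]

end Spectral

/-! ### Smoothness and differentiation under the expectation -/

section Smooth

variable {d : ℕ}

/-- A function with Lipschitz gradient is approximated to second order by its linearization. -/
theorem abs_sub_inner_gradient_le {f : EuclideanSpace ℝ (Fin d) → ℝ}
    (hf : Differentiable ℝ f) {K : ℝ≥0} (hK : LipschitzWith K (∇ f))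
    (x y : EuclideanSpace ℝ (Fin d)) :
    |f y - f x - inner ℝ (∇ f x) (y - x)| ≤ K * ‖y - x‖ ^ 2 := by
  have hfd : ∀ z, fderiv ℝ f z = InnerProductSpace.toDual ℝ _ (∇ f z) := by
    intro z; simp [gradient]
  -- The mean value inequality on a ball around x gives the constant K; the sharper K/2 is not
  -- needed.
  have h := (convex_closedBall x ‖y - x‖).norm_image_sub_le_of_norm_fderiv_le'
    (f := f) (φ := fderiv ℝ f x) (C := K * ‖y - x‖) (x := x) (y := y) (𝕜 := ℝ)
    (fun z _ => hf z) (fun z hz => ?_) (by simp) (by simp [dist_eq_norm])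
  · rw [hfd, InnerProductSpace.toDual_apply_apply, Real.norm_eq_abs] at h
    exact h.trans_eq (by ring)
  · rw [hfd, hfd, ← map_sub, LinearIsometryEquiv.norm_map]
    refine (hK.norm_sub_le _ _).trans ?_
    gcongr
    simpa [dist_eq_norm] using hz

variable {Z : Type*} {ℓ : EuclideanSpace ℝ (Fin d) → Z → ℝ}

theorem abs_sub_inner_stochGrad_le (hdiff : ∀ z, Differentiable ℝ fun x => ℓ x z) {K : ℝ≥0}
    (hlip : ∀ z, LipschitzWith K (stochGrad ℓ z)) (x y : EuclideanSpace ℝ (Fin d)) (z : Z) :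
    |ℓ y z - ℓ x z - inner ℝ (stochGrad ℓ z x) (y - x)| ≤ K * ‖y - x‖ ^ 2 :=
  abs_sub_inner_gradient_le (hdiff z) (hlip z) x y

variable [MeasurableSpace Z]

/-- The coordinates of the stochastic gradient as a limit of difference quotients. -/
theorem measurable_inner_stochGrad (hmeas : ∀ x, Measurable (ℓ x))
    (hdiff : ∀ z, Differentiable ℝ fun x => ℓ x z) (x v : EuclideanSpace ℝ (Fin d)) :
    Measurable fun z => inner ℝ (stochGrad ℓ z x) v := by
  refine measurable_of_tendsto_metrizable
    (f := fun (n : ℕ) z => (n : ℝ) • (ℓ (x + (n : ℝ)⁻¹ • v) z - ℓ x z))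
    (fun n => ((hmeas _).sub (hmeas _)).const_smul (n : ℝ)) (tendsto_pi_nhds.2 fun z => ?_)
  have h := (hdiff z x).hasFDerivAt
  have h2 := h.lim v (c := fun n : ℕ => (n : ℝ)) (l := Filter.atTop) ?_
  · convert h2 using 2
    simp [stochGrad, gradient]
  · simpa using tendsto_natCast_atTop_atTop (R := ℝ)

theorem measurable_stochGrad (hmeas : ∀ x, Measurable (ℓ x))
    (hdiff : ∀ z, Differentiable ℝ fun x => ℓ x z) (x : EuclideanSpace ℝ (Fin d)) :
    Measurable fun z => stochGrad ℓ z x := by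
  have : (fun z => stochGrad ℓ z x) = fun z =>
      ∑ k, inner ℝ (stochGrad ℓ z x) (EuclideanSpace.basisFun (Fin d) ℝ k) •
        EuclideanSpace.basisFun (Fin d) ℝ k := by
    ext1 z
    conv_lhs => rw [← (EuclideanSpace.basisFun (Fin d) ℝ).sum_repr' (stochGrad ℓ z x)]
    simp only [real_inner_comm]
  rw [this]
  exact Finset.measurable_sum _ fun k _ =>
    (measurable_inner_stochGrad hmeas hdiff x _).smul_const _

/-- A Carathéodory function: continuous in the model and measurable in the sample. Joint
measurability is what allows random models to be inserted. -/
theorem measurable_stochGrad_uncurry (hmeas : ∀ x, Measurable (ℓ x))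
    (hdiff : ∀ z, Differentiable ℝ fun x => ℓ x z) {K : ℝ≥0}
    (hlip : ∀ z, LipschitzWith K (stochGrad ℓ z)) :
    Measurable fun p : EuclideanSpace ℝ (Fin d) × Z => stochGrad ℓ p.2 p.1 :=
  measurable_uncurry_of_continuous_of_measurable (u := fun x z => stochGrad ℓ z x)
    (fun z => (hlip z).continuous) (measurable_stochGrad hmeas hdiff)

variable {D : Measure Z} [IsProbabilityMeasure D]

/-- Each directional derivative differs by at most K‖v‖² from a difference of two losses, which is
integrable. -/
theorem integrable_stochGrad (hmeas : ∀ x, Measurable (ℓ x)) (hinteg : ∀ x, Integrable (ℓ x) D)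
    (hdiff : ∀ z, Differentiable ℝ fun x => ℓ x z) {K : ℝ≥0}
    (hlip : ∀ z, LipschitzWith K (stochGrad ℓ z)) (x : EuclideanSpace ℝ (Fin d)) :
    Integrable (fun z => stochGrad ℓ z x) D := by
  have : (fun z => stochGrad ℓ z x) = fun z =>
      ∑ k, inner ℝ (stochGrad ℓ z x) (EuclideanSpace.basisFun (Fin d) ℝ k) •
        EuclideanSpace.basisFun (Fin d) ℝ k := by
    ext1 z
    conv_lhs => rw [← (EuclideanSpace.basisFun (Fin d) ℝ).sum_repr' (stochGrad ℓ z x)]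
    simp only [real_inner_comm]
  rw [this]
  refine integrable_finsetSum _ fun k _ => Integrable.smul_const ?_ _
  set v := EuclideanSpace.basisFun (Fin d) ℝ k
  refine (((hinteg (x + v)).sub (hinteg x)).abs.add (integrable_const (K * ‖v‖ ^ 2))).mono'
    (measurable_inner_stochGrad hmeas hdiff x v).aestronglyMeasurable (ae_of_all _ fun z => ?_)
  have h := abs_sub_inner_stochGrad_le hdiff hlip x (x + v) z
  rw [add_sub_cancel_left, abs_sub_comm] at h
  have h2 := abs_sub_abs_le_abs_sub (inner ℝ (stochGrad ℓ z x) v) (ℓ (x + v) z - ℓ x z)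
  simp only [Real.norm_eq_abs, Pi.add_apply, Pi.sub_apply]
  linarith

/-- The quadratic remainder bound is uniform in the sample, so integrating it gives
differentiability directly, with no dominated convergence. -/
theorem hasGradientAt_localObjective (hmeas : ∀ x, Measurable (ℓ x))
    (hinteg : ∀ x, Integrable (ℓ x) D)
    (hdiff : ∀ z, Differentiable ℝ fun x => ℓ x z) {K : ℝ≥0}
    (hlip : ∀ z, LipschitzWith K (stochGrad ℓ z)) (x : EuclideanSpace ℝ (Fin d)) :
    HasGradientAt (localObjective ℓ D) (∫ z, stochGrad ℓ z x ∂D) x := by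
  rw [hasGradientAt_iff_isLittleO]
  have hi := integrable_stochGrad hmeas hinteg hdiff hlip x
  have hbd : ∀ y, ‖localObjective ℓ D y - localObjective ℓ D x
      - inner ℝ (∫ z, stochGrad ℓ z x ∂D) (y - x)‖ ≤ K * ‖‖y - x‖ ^ 2‖ := by
    intro y
    have h1 : inner ℝ (∫ z, stochGrad ℓ z x ∂D) (y - x)
        = ∫ z, inner ℝ (stochGrad ℓ z x) (y - x) ∂D := by
      rw [real_inner_comm, ← integral_inner hi]
      simp only [real_inner_comm]
    have h2 := hi.inner_const (𝕜 := ℝ) (y - x)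
    rw [h1, localObjective, localObjective, ← integral_sub (hinteg y) (hinteg x),
      ← integral_sub (f := fun z => ℓ y z - ℓ x z) ((hinteg y).sub (hinteg x)) h2]
    refine (norm_integral_le_of_norm_le_const (C := K * ‖y - x‖ ^ 2)
      (ae_of_all _ fun z => ?_)).trans ?_
    · exact abs_sub_inner_stochGrad_le hdiff hlip x y z
    · simp
  refine (Asymptotics.IsBigO.of_bound K (Filter.Eventually.of_forall hbd)).trans_isLittleO ?_
  have h0 : Filter.Tendsto (fun y => y - x) (nhds x) (nhds 0) := by
    simpa using (continuous_sub_right x).tendsto x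
  exact (Asymptotics.isLittleO_norm_pow_id one_lt_two).comp_tendsto h0

theorem lipschitzWith_gradient_localObjective (hmeas : ∀ x, Measurable (ℓ x))
    (hinteg : ∀ x, Integrable (ℓ x) D)
    (hdiff : ∀ z, Differentiable ℝ fun x => ℓ x z) {K : ℝ≥0}
    (hlip : ∀ z, LipschitzWith K (stochGrad ℓ z)) :
    LipschitzWith K (∇ (localObjective ℓ D)) := by
  refine LipschitzWith.of_dist_le_mul fun x y => ?_
  rw [(hasGradientAt_localObjective hmeas hinteg hdiff hlip x).gradient,
    (hasGradientAt_localObjective hmeas hinteg hdiff hlip y).gradient, dist_eq_norm, dist_eq_norm,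
    ← integral_sub (integrable_stochGrad hmeas hinteg hdiff hlip x)
      (integrable_stochGrad hmeas hinteg hdiff hlip y)]
  refine (norm_integral_le_of_norm_le_const (C := K * ‖x - y‖)
    (ae_of_all _ fun z => (hlip z).norm_sub_le x y)).trans ?_
  simp

end Smooth

/-! ### The global objective -/

section Global

variable {m d : ℕ} {Ξ : Fin m → Type*} [∀ i, MeasurableSpace (Ξ i)]
  {ℓ : (i : Fin m) → EuclideanSpace ℝ (Fin d) → Ξ i → ℝ} {D : (i : Fin m) → Measure (Ξ i)}

theorem hasGradientAt_globalObjective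
    (h : ∀ i, Differentiable ℝ (localObjective (ℓ i) (D i))) (x : EuclideanSpace ℝ (Fin d)) :
    HasGradientAt (globalObjective ℓ D)
      (mean fun i => ∇ (localObjective (ℓ i) (D i)) x) x := by
  have h1 := (HasFDerivAt.fun_sum fun i (_ : i ∈ Finset.univ) =>
    ((h i x).hasGradientAt.hasFDerivAt)).const_mul (1 / (m : ℝ))
  rw [hasGradientAt_iff_hasFDerivAt]
  have h2 : InnerProductSpace.toDual ℝ _ (mean fun i => ∇ (localObjective (ℓ i) (D i)) x)
      = (1 / (m : ℝ)) • ∑ i, InnerProductSpace.toDual ℝ _ (∇ (localObjective (ℓ i) (D i)) x) := by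
    simp [mean, map_sum]
  rw [h2]
  exact h1

theorem lipschitzWith_gradient_globalObjective (hm : 0 < m)
    (h : ∀ i, Differentiable ℝ (localObjective (ℓ i) (D i))) {K : ℝ≥0}
    (hlip : ∀ i, LipschitzWith K (∇ (localObjective (ℓ i) (D i)))) :
    LipschitzWith K (∇ (globalObjective ℓ D)) := by
  refine LipschitzWith.of_dist_le_mul fun x y => ?_
  have hm' : (0 : ℝ) < m := by exact_mod_cast hm
  rw [(hasGradientAt_globalObjective h x).gradient, (hasGradientAt_globalObjective h y).gradient,
    dist_eq_norm, dist_eq_norm, mean, mean, ← smul_sub, ← Finset.sum_sub_distrib, norm_smul]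
  have : ‖∑ i, (∇ (localObjective (ℓ i) (D i)) x - ∇ (localObjective (ℓ i) (D i)) y)‖
      ≤ ∑ _i : Fin m, K * ‖x - y‖ :=
    norm_sum_le_of_le _ fun i _ => (hlip i).norm_sub_le x y
  rw [Real.norm_of_nonneg (by positivity)]
  refine (mul_le_mul_of_nonneg_left this (by positivity)).trans_eq ?_
  simp
  field_simp

end Global

theorem integrable_inner_of_memLp {Ω : Type*} [MeasurableSpace Ω] {P : Measure Ω} {V : Type*}
    [NormedAddCommGroup V] [InnerProductSpace ℝ V] {f g : Ω → V}
    (hf : MemLp f 2 P) (hg : MemLp g 2 P) :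
    Integrable (fun ω => inner ℝ (f ω) (g ω)) P :=
  (hf.norm.integrable_mul hg.norm).mono' (hf.1.inner hg.1)
    (ae_of_all _ fun _ => norm_inner_le_norm _ _)

/-! ### Conditional expectations at random points -/

section CondExp

variable {Ω : Type*} {𝓖 mΩ : MeasurableSpace Ω} {P : Measure Ω} [IsProbabilityMeasure P]

/-- A conditional bound on `φ x` for every deterministic `x` carries over to random points that are
measurable with respect to the conditioning σ-algebra. -/
theorem lintegral_comp_le_of_condExp_le (h𝓖 : 𝓖 ≤ mΩ) {V : Type*} [TopologicalSpace V]
    {φ : V → Ω → ℝ} (hcont : ∀ ω, Continuous fun x => φ x ω) (hnn : ∀ x ω, 0 ≤ φ x ω)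
    (hinteg : ∀ x, Integrable (φ x) P) (hmeas : ∀ x, Measurable (φ x)) {C : ℝ}
    (hC : ∀ x, P[φ x | 𝓖] ≤ᵐ[P] fun _ => C)
    {X : Ω → V} (hX : StronglyMeasurable[𝓖] X) :
    ∫⁻ ω, ENNReal.ofReal (φ (X ω) ω) ∂P ≤ ENNReal.ofReal C := by
  -- The bound localized to events of 𝓖 lets a 𝓖-measurable simple function be treated one fibre at
  -- a time.
  have hset : ∀ x (B : Set Ω), MeasurableSet[𝓖] B →
      ∫⁻ ω in B, ENNReal.ofReal (φ x ω) ∂P ≤ ENNReal.ofReal C * P B := by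
    intro x B hB
    rw [← ofReal_integral_eq_lintegral_ofReal (hinteg x).integrableOn (ae_of_all _ (hnn x)),
      ← setIntegral_condExp h𝓖 (hinteg x) hB]
    have h1 : ∫ ω in B, (P[φ x | 𝓖]) ω ∂P ≤ C * P.real B := by
      refine (setIntegral_mono_ae integrable_condExp.integrableOn
        (integrable_const C).integrableOn (hC x)).trans_eq ?_
      simp [mul_comm]
    refine (ENNReal.ofReal_le_ofReal h1).trans_eq ?_
    rw [ENNReal.ofReal_mul' measureReal_nonneg, ofReal_measureReal]
  obtain ⟨S, hS, hSlim⟩ : ∃ S : ℕ → SimpleFunc Ω V, (∀ n x, MeasurableSet[𝓖] (S n ⁻¹' {x})) ∧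
      ∀ ω, Filter.Tendsto (fun n => S n ω) Filter.atTop (nhds (X ω)) :=
    have hfib n := @SimpleFunc.measurableSet_fiber Ω V 𝓖 (hX.approx n)
    ⟨fun n => ⟨hX.approx n, fun x => h𝓖 _ (hfib n x),
      @SimpleFunc.finite_range Ω V 𝓖 (hX.approx n)⟩, hfib, hX.tendsto_approx⟩
  have hsimple : ∀ n, ∫⁻ ω, ENNReal.ofReal (φ (S n ω) ω) ∂P ≤ ENNReal.ofReal C := by
    intro n
    have huniv : (⋃ x ∈ (S n).range, S n ⁻¹' {x}) = Set.univ := by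
      ext ω; simp
    have hdisj : ((S n).range : Set V).PairwiseDisjoint fun x => S n ⁻¹' {x} :=
      fun x _ y _ hxy => Set.disjoint_left.2 fun ω h1 h2 =>
        hxy ((Set.mem_singleton_iff.1 h1).symm.trans (Set.mem_singleton_iff.1 h2))
    calc ∫⁻ ω, ENNReal.ofReal (φ (S n ω) ω) ∂P
        = ∑ x ∈ (S n).range, ∫⁻ ω in S n ⁻¹' {x}, ENNReal.ofReal (φ (S n ω) ω) ∂P := by
          rw [← lintegral_biUnion_finset hdisj (fun x _ => h𝓖 _ (hS n x)), huniv,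
            Measure.restrict_univ]
      _ = ∑ x ∈ (S n).range, ∫⁻ ω in S n ⁻¹' {x}, ENNReal.ofReal (φ x ω) ∂P := by
          refine Finset.sum_congr rfl fun x _ => setLIntegral_congr_fun (h𝓖 _ (hS n x)) ?_
          intro ω hω
          simp only [Set.mem_preimage, Set.mem_singleton_iff] at hω
          simp only [hω]
      _ ≤ ∑ x ∈ (S n).range, ENNReal.ofReal C * P (S n ⁻¹' {x}) :=
          Finset.sum_le_sum fun x _ => hset x _ (hS n x)
      _ = ENNReal.ofReal C := by
          rw [← Finset.mul_sum, ← measure_biUnion_finset hdisj (fun x _ => h𝓖 _ (hS n x)), huniv,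
            measure_univ, mul_one]
  have hlim : ∀ ω, Filter.Tendsto (fun n => ENNReal.ofReal (φ (S n ω) ω)) Filter.atTop
      (nhds (ENNReal.ofReal (φ (X ω) ω))) := fun ω =>
    (ENNReal.continuous_ofReal.comp (hcont ω)).continuousAt.tendsto.comp (hSlim ω)
  -- Fatou's lemma along the simple approximations, using continuity of φ in the point. Working with
  -- `lintegral` avoids presupposing integrability at the random point.
  calc ∫⁻ ω, ENNReal.ofReal (φ (X ω) ω) ∂P
      = ∫⁻ ω, Filter.liminf (fun n => ENNReal.ofReal (φ (S n ω) ω)) Filter.atTop ∂P := by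
        simp only [(hlim _).liminf_eq]
    _ ≤ Filter.liminf (fun n => ∫⁻ ω, ENNReal.ofReal (φ (S n ω) ω) ∂P) Filter.atTop := by
        refine lintegral_liminf_le fun n => ENNReal.measurable_ofReal.comp ?_
        exact (S n).measurable_bind φ hmeas
    _ ≤ ENNReal.ofReal C := by
        refine (Filter.liminf_le_liminf (Filter.Eventually.of_forall hsimple)).trans_eq ?_
        simp

variable {V : Type*} [NormedAddCommGroup V] [InnerProductSpace ℝ V] [CompleteSpace V]

/-- The 𝓖-measurable factor is pulled out of the conditional expectation. -/
theorem integral_inner_eq_of_condExp (h𝓖 : 𝓖 ≤ mΩ) {φ g h : Ω → V}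
    (hφm : StronglyMeasurable[𝓖] φ) (hφ : MemLp φ 2 P) (hg : MemLp g 2 P)
    (hgh : P[g | 𝓖] =ᵐ[P] h) :
    ∫ ω, inner ℝ (φ ω) (g ω) ∂P = ∫ ω, inner ℝ (φ ω) (h ω) ∂P := by
  have h1 := condExp_bilin_of_stronglyMeasurable_left (m := 𝓖) (μ := P) (innerSL ℝ) hφm
    (integrable_inner_of_memLp hφ hg) (hg.integrable one_le_two)
  rw [← integral_condExp h𝓖]
  refine integral_congr_ae ?_
  filter_upwards [h1, hgh] with ω h2 h3
  have h4 : (P[fun ω => inner ℝ (φ ω) (g ω) | 𝓖]) ω = inner ℝ (φ ω) ((P[g | 𝓖]) ω) := h2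
  rw [h4, h3]

end CondExp

/-! ### The iteration as gossip, and its measurability -/

section Dynamics

variable {m d : ℕ} {Ξ : Fin m → Type*}
  {ℓ : (i : Fin m) → EuclideanSpace ℝ (Fin d) → Ξ i → ℝ}
  {Ω : Type*} {ξ : (i : Fin m) → ℕ → Ω → Ξ i} {A : ℕ → Ω → Finset (Fin m)}
  {η : ℝ} {s : ℕ} {x₀ : EuclideanSpace ℝ (Fin d)}

/-- The stochastic gradient of client `i` at the start of round `t`. -/
noncomputable def startGrad (ℓ : (i : Fin m) → EuclideanSpace ℝ (Fin d) → Ξ i → ℝ)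
    (ξ : (i : Fin m) → ℕ → Ω → Ξ i) (A : ℕ → Ω → Finset (Fin m)) (η : ℝ) (s : ℕ)
    (x₀ : EuclideanSpace ℝ (Fin d)) (t : ℕ) (i : Fin m) (ω : Ω) : EuclideanSpace ℝ (Fin d) :=
  stochGrad (ℓ i) (ξ i t ω) (clientModel ℓ ξ A η s x₀ t i ω)

/-- The sum of the stochastic gradients used by client `i` in round `t`. -/
noncomputable def roundGrad (ℓ : (i : Fin m) → EuclideanSpace ℝ (Fin d) → Ξ i → ℝ)
    (ξ : (i : Fin m) → ℕ → Ω → Ξ i) (A : ℕ → Ω → Finset (Fin m)) (η : ℝ) (s : ℕ)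
    (x₀ : EuclideanSpace ℝ (Fin d)) (t : ℕ) (i : Fin m) (ω : Ω) : EuclideanSpace ℝ (Fin d) :=
  pathGrad (stochGrad (ℓ i) (ξ i t ω)) η (clientModel ℓ ξ A η s x₀ t i ω) s

/-- The model of client `i` at the end of the local steps of round `t`. -/
noncomputable def localModel (ℓ : (i : Fin m) → EuclideanSpace ℝ (Fin d) → Ξ i → ℝ)
    (ξ : (i : Fin m) → ℕ → Ω → Ξ i) (A : ℕ → Ω → Finset (Fin m)) (η : ℝ) (s : ℕ)
    (x₀ : EuclideanSpace ℝ (Fin d)) (t : ℕ) (i : Fin m) (ω : Ω) : EuclideanSpace ℝ (Fin d) :=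
  localSteps (stochGrad (ℓ i) (ξ i t ω)) η (clientModel ℓ ξ A η s x₀ t i ω) s

theorem localModel_eq (t : ℕ) (i : Fin m) (ω : Ω) :
    localModel ℓ ξ A η s x₀ t i ω
      = clientModel ℓ ξ A η s x₀ t i ω - η • roundGrad ℓ ξ A η s x₀ t i ω :=
  localSteps_eq_sub_pathGrad _ _ _ _

theorem clientModel_succ (t : ℕ) (i : Fin m) (ω : Ω) :
    clientModel ℓ ξ A η s x₀ (t + 1) i ω
      = ∑ j, gossipMatrix (A t ω) i j • localModel ℓ ξ A η s x₀ t j ω :=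
  round_snd _ _ _ _ _ _

theorem avgModel_eq (t : ℕ) (ω : Ω) :
    avgModel ℓ ξ A η s x₀ t ω = mean fun i => clientModel ℓ ξ A η s x₀ t i ω := rfl

theorem avgModel_succ (t : ℕ) (ω : Ω) :
    avgModel ℓ ξ A η s x₀ (t + 1) ω = mean fun i => localModel ℓ ξ A η s x₀ t i ω := by
  rw [avgModel_eq]
  simp only [clientModel_succ]
  exact mean_gossip _ _

theorem avgModel_succ_eq_sub (t : ℕ) (ω : Ω) :
    avgModel ℓ ξ A η s x₀ (t + 1) ω = avgModel ℓ ξ A η s x₀ t ω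
      - η • mean fun i => roundGrad ℓ ξ A η s x₀ t i ω := by
  rw [avgModel_succ, avgModel_eq]
  simp only [mean, localModel_eq, Finset.sum_sub_distrib, smul_sub, ← Finset.smul_sum]
  rw [smul_comm]

/-! ### Measurability -/

variable [∀ i, MeasurableSpace (Ξ i)]

theorem measurable_localSteps {Z : Type*} [MeasurableSpace Z]
    {f : EuclideanSpace ℝ (Fin d) → Z → ℝ}
    (hf : Measurable fun p : EuclideanSpace ℝ (Fin d) × Z => stochGrad f p.2 p.1)
    [MeasurableSpace Ω] {ζ : Ω → Z} (hζ : Measurable ζ) {X : Ω → EuclideanSpace ℝ (Fin d)}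
    (hX : Measurable X) (n : ℕ) :
    Measurable fun ω => localSteps (stochGrad f (ζ ω)) η (X ω) n := by
  induction n with
  | zero => exact hX
  | succ n ih => exact ih.sub ((hf.comp (ih.prodMk hζ)).const_smul η)

theorem sampleSigma_le_history_succ (t : ℕ) : sampleSigma ξ t ≤ history ξ A (t + 1) :=
  le_sup_left.trans (le_iSup (fun r : Fin (t + 1) => sampleSigma ξ r ⊔ linkSigma A r) (Fin.last t))

theorem linkSigma_le_history_succ (t : ℕ) : linkSigma A t ≤ history ξ A (t + 1) :=
  le_sup_right.trans (le_iSup (fun r : Fin (t + 1) => sampleSigma ξ r ⊔ linkSigma A r) (Fin.last t))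

theorem history_le_succ (t : ℕ) : history ξ A t ≤ history ξ A (t + 1) :=
  iSup_le fun r => le_iSup (fun r : Fin (t + 1) => sampleSigma ξ r ⊔ linkSigma A r) r.castSucc

theorem measurable_sample (t : ℕ) (i : Fin m) : Measurable[sampleSigma ξ t] (ξ i t) :=
  (comap_measurable (ξ i t)).mono (le_iSup (fun i => MeasurableSpace.comap (ξ i t) _) i) le_rfl

theorem sampleSigma_le [MeasurableSpace Ω] (hξ : ∀ i t, Measurable (ξ i t)) (t : ℕ) :
    sampleSigma ξ t ≤ ‹MeasurableSpace Ω› :=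
  iSup_le fun i => (hξ i t).comap_le

theorem history_le [MeasurableSpace Ω] (hξ : ∀ i t, Measurable (ξ i t))
    (hA : ∀ t, Measurable[_, ⊤] (A t)) (t : ℕ) : history ξ A t ≤ ‹MeasurableSpace Ω› :=
  iSup_le fun r => sup_le (sampleSigma_le hξ r) (hA r).comap_le

theorem measurable_comp_link {β : Type*} [MeasurableSpace β] (f : Finset (Fin m) → β) (t : ℕ) :
    Measurable[linkSigma A t] fun ω => f (A t ω) :=
  (measurable_from_top (f := f)).comp (comap_measurable (A t))

/-- The local steps precede communication, so the active set of the same round does not enter: this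
is the σ-algebra of the independence hypothesis. The assumption on the client models is what the
induction in `measurable_clientModel` supplies. -/
theorem measurable_localModel_of
    (hg : ∀ i, Measurable fun p : EuclideanSpace ℝ (Fin d) × Ξ i => stochGrad (ℓ i) p.2 p.1)
    {t : ℕ} (h : ∀ i, Measurable[history ξ A t] (clientModel ℓ ξ A η s x₀ t i)) (i : Fin m) :
    Measurable[history ξ A t ⊔ sampleSigma ξ t] (localModel ℓ ξ A η s x₀ t i) :=
  @measurable_localSteps d Ω η (Ξ i) _ (ℓ i) (hg i) (history ξ A t ⊔ sampleSigma ξ t) (ξ i t)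
    ((measurable_sample t i).mono le_sup_right le_rfl) _ ((h i).mono le_sup_left le_rfl) s

theorem measurable_clientModel
    (hg : ∀ i, Measurable fun p : EuclideanSpace ℝ (Fin d) × Ξ i => stochGrad (ℓ i) p.2 p.1)
    (t : ℕ) (i : Fin m) : Measurable[history ξ A t] (clientModel ℓ ξ A η s x₀ t i) := by
  induction t generalizing i with
  | zero => exact measurable_const
  | succ t ih =>
    have h : clientModel ℓ ξ A η s x₀ (t + 1) i = fun ω =>
        ∑ j, gossipMatrix (A t ω) i j • localModel ℓ ξ A η s x₀ t j ω :=
      funext fun ω => clientModel_succ t i ω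
    rw [h]
    refine Finset.measurable_sum _ fun j _ => Measurable.fun_smul ?_ ?_
    · exact (measurable_comp_link (fun S => gossipMatrix S i j) t).mono
        (linkSigma_le_history_succ t) le_rfl
    · exact (measurable_localModel_of hg ih j).mono
        (sup_le (history_le_succ t) (sampleSigma_le_history_succ t)) le_rfl

theorem measurable_localModel
    (hg : ∀ i, Measurable fun p : EuclideanSpace ℝ (Fin d) × Ξ i => stochGrad (ℓ i) p.2 p.1)
    (t : ℕ) (i : Fin m) :
    Measurable[history ξ A t ⊔ sampleSigma ξ t] (localModel ℓ ξ A η s x₀ t i) :=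
  measurable_localModel_of hg (measurable_clientModel hg t) i

end Dynamics

/-! ### Averages of squares and spread -/

section AvgSq

variable {m : ℕ} {E : Type*} [NormedAddCommGroup E]

/-- The average of the squared norms of a finite family of vectors. -/
noncomputable def avgSq (x : Fin m → E) : ℝ := (1 / (m : ℝ)) * ∑ i, ‖x i‖ ^ 2

theorem avgSq_nonneg (x : Fin m → E) : 0 ≤ avgSq x := by unfold avgSq; positivity

theorem avgSq_le_of_le {x : Fin m → E} {y : Fin m → ℝ} (h : ∀ i, ‖x i‖ ^ 2 ≤ y i) :
    avgSq x ≤ (1 / (m : ℝ)) * ∑ i, y i := by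
  unfold avgSq
  gcongr
  exact h _

/-- A Young inequality that spends one of the two factors r, leaving a contraction by r at the price
1/(1 − r) on the perturbation. With λ₂ ≤ r² this is how √ρ, not ρ, enters the rate. -/
theorem sq_mul_norm_sub_sq_le {r : ℝ} (hr0 : 0 ≤ r) (hr1 : r < 1) (a b : E) :
    r ^ 2 * ‖a - b‖ ^ 2 ≤ r * ‖a‖ ^ 2 + 1 / (1 - r) * ‖b‖ ^ 2 := by
  have hc : 0 < 1 - r := by linarith
  have h1 : ‖a - b‖ ^ 2 ≤ (‖a‖ + ‖b‖) ^ 2 := by gcongr; exact norm_sub_le a b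
  have h2 : r ^ 2 * ‖a - b‖ ^ 2 ≤ r ^ 2 * (‖a‖ + ‖b‖) ^ 2 := by gcongr
  refine h2.trans ?_
  set p := ‖a‖
  set q := ‖b‖
  have key : 0 ≤ (1 - r) * (r * p ^ 2 + 1 / (1 - r) * q ^ 2 - r ^ 2 * (p + q) ^ 2) := by
    have : (1 - r) * (r * p ^ 2 + 1 / (1 - r) * q ^ 2 - r ^ 2 * (p + q) ^ 2)
        = r * ((1 - r) * p - r * q) ^ 2 + (1 - r ^ 2) * q ^ 2 := by
      field_simp
      ring
    rw [this]
    have : 0 ≤ 1 - r ^ 2 := by nlinarith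
    positivity
  nlinarith [nonneg_of_mul_nonneg_right key hc]

variable [InnerProductSpace ℝ E]

/-- The mean squared distance of a finite family of vectors to its average. -/
noncomputable def spread (x : Fin m → E) : ℝ := avgSq fun i => x i - mean x

theorem spread_nonneg (x : Fin m → E) : 0 ≤ spread x := avgSq_nonneg _

theorem sum_eq_smul_mean (hm : 0 < m) (x : Fin m → E) : ∑ i, x i = (m : ℝ) • mean x := by
  have : (m : ℝ) ≠ 0 := by positivity
  rw [mean, smul_smul, mul_one_div_cancel this, one_smul]

theorem sum_sub_mean (hm : 0 < m) (x : Fin m → E) : ∑ i, (x i - mean x) = 0 := by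
  rw [Finset.sum_sub_distrib, sum_eq_smul_mean hm]
  simp [Nat.cast_smul_eq_nsmul]

theorem avgSq_sub (hm : 0 < m) (x : Fin m → E) (c : E) :
    avgSq (fun i => x i - c) = avgSq x - 2 * inner ℝ (mean x) c + ‖c‖ ^ 2 := by
  have : (m : ℝ) ≠ 0 := by positivity
  simp only [avgSq, norm_sub_sq_real, Finset.sum_add_distrib, Finset.sum_sub_distrib,
    ← Finset.mul_sum, ← sum_inner, sum_eq_smul_mean hm x, real_inner_smul_left]
  simp
  field_simp

theorem spread_eq (hm : 0 < m) (x : Fin m → E) : spread x = avgSq x - ‖mean x‖ ^ 2 := by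
  rw [spread, avgSq_sub hm, real_inner_self_eq_norm_sq]
  ring

theorem norm_mean_sq_le (hm : 0 < m) (x : Fin m → E) : ‖mean x‖ ^ 2 ≤ avgSq x := by
  linarith [spread_nonneg x, spread_eq hm x]

theorem spread_le_avgSq (hm : 0 < m) (x : Fin m → E) : spread x ≤ avgSq x := by
  linarith [sq_nonneg ‖mean x‖, spread_eq hm x]

theorem mean_sub (x y : Fin m → E) : mean (fun i => x i - y i) = mean x - mean y := by
  simp [mean, Finset.sum_sub_distrib, smul_sub]

theorem mean_smul (c : ℝ) (x : Fin m → E) : mean (fun i => c • x i) = c • mean x := by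
  simp only [mean, ← Finset.smul_sum]
  rw [smul_comm]

theorem sq_mul_spread_sub_le (hm : 0 < m) {r : ℝ} (hr0 : 0 ≤ r) (hr1 : r < 1) (η : ℝ)
    (x G : Fin m → E) :
    r ^ 2 * spread (fun i => x i - η • G i)
      ≤ r * spread x + 1 / (1 - r) * (η ^ 2 * avgSq G) := by
  have hc : 0 < 1 - r := by linarith
  have h1 : r ^ 2 * spread (fun i => x i - η • G i)
      ≤ r * spread x + 1 / (1 - r) * spread (fun i => η • G i) := by
    simp only [spread, avgSq, ← mul_assoc, mul_comm _ (1 / (m : ℝ))]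
    simp only [mul_assoc, ← mul_add]
    gcongr
    rw [Finset.mul_sum, Finset.mul_sum, Finset.mul_sum, ← Finset.sum_add_distrib]
    refine Finset.sum_le_sum fun i _ => ?_
    rw [mean_sub, sub_sub_sub_comm]
    exact sq_mul_norm_sub_sq_le hr0 hr1 _ _
  have h2 : spread (fun i => η • G i) ≤ η ^ 2 * avgSq G := by
    refine (spread_le_avgSq hm _).trans_eq ?_
    simp only [avgSq, norm_smul, mul_pow, ← Finset.mul_sum, Real.norm_eq_abs, sq_abs]
    ring
  exact h1.trans (by gcongr)

end AvgSq

/-! ### Drift bounds and square integrability of the iterates -/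

section SquareIntegrable

theorem abs_gossipMatrix_le_one {m : ℕ} (S : Finset (Fin m)) (i j : Fin m) :
    |gossipMatrix S i j| ≤ 1 := by
  have hnn : ∀ k, 0 ≤ gossipMatrix S i k := by
    intro k
    simp only [gossipMatrix, Matrix.of_apply]
    split_ifs <;> positivity
  rw [abs_of_nonneg (hnn j), ← sum_gossipMatrix S i]
  exact Finset.single_le_sum (fun k _ => hnn k) (Finset.mem_univ j)

variable {m d : ℕ} {Ξ : Fin m → Type*}
  {ℓ : (i : Fin m) → EuclideanSpace ℝ (Fin d) → Ξ i → ℝ}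
  {Ω : Type*} {ξ : (i : Fin m) → ℕ → Ω → Ξ i} {A : ℕ → Ω → Finset (Fin m)}
  {η : ℝ} {s : ℕ} {x₀ : EuclideanSpace ℝ (Fin d)} {L : Fin m → ℝ≥0}

/-- The relative drift of the local steps away from `s` steps along the initial gradient. -/
noncomputable def drift (L : Fin m → ℝ≥0) (η : ℝ) (s : ℕ) : ℝ :=
  kappa L η s * s.choose 2 * η * maxLip L

/-- This pathwise comparison replaces unbiasedness for the later gradients of a round, whose
evaluation points depend on the sample in use. -/
theorem norm_roundGrad_sub_le (hη : 0 < η) (hlip : ∀ i z, LipschitzWith (L i) (stochGrad (ℓ i) z))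
    (t : ℕ) (i : Fin m) (ω : Ω) :
    ‖roundGrad ℓ ξ A η s x₀ t i ω - (s : ℝ) • startGrad ℓ ξ A η s x₀ t i ω‖
      ≤ drift L η s * ‖startGrad ℓ ξ A η s x₀ t i ω‖ :=
  (norm_pathGrad_sub_le (hlip i _) hη.le _ s).trans
    (mul_le_mul_of_nonneg_right (sum_one_add_pow_sub_one_le_kappa L hη s i) (norm_nonneg _))

theorem norm_roundGrad_le (hη : 0 < η) (hlip : ∀ i z, LipschitzWith (L i) (stochGrad (ℓ i) z))
    (t : ℕ) (i : Fin m) (ω : Ω) :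
    ‖roundGrad ℓ ξ A η s x₀ t i ω‖
      ≤ (s + drift L η s) * ‖startGrad ℓ ξ A η s x₀ t i ω‖ := by
  have h1 := norm_roundGrad_sub_le (s := s) (ξ := ξ) (A := A) (x₀ := x₀) hη hlip t i ω
  have h2 := norm_le_norm_add_norm_sub ((s : ℝ) • startGrad ℓ ξ A η s x₀ t i ω)
    (roundGrad ℓ ξ A η s x₀ t i ω)
  rw [norm_sub_rev, norm_smul, Real.norm_natCast] at h2
  linarith

variable [∀ i, MeasurableSpace (Ξ i)] [MeasurableSpace Ω] {P : Measure Ω}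

theorem memLp_startGrad (hξ : ∀ i t, Measurable (ξ i t)) (hA : ∀ t, Measurable[_, ⊤] (A t))
    (hg : ∀ i, Measurable fun p : EuclideanSpace ℝ (Fin d) × Ξ i => stochGrad (ℓ i) p.2 p.1)
    (hlip : ∀ i z, LipschitzWith (L i) (stochGrad (ℓ i) z)) {t : ℕ} {i : Fin m}
    (h0 : MemLp (fun ω => stochGrad (ℓ i) (ξ i t ω) 0) 2 P)
    (hX : MemLp (clientModel ℓ ξ A η s x₀ t i) 2 P) :
    MemLp (startGrad ℓ ξ A η s x₀ t i) 2 P := by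
  have hm : Measurable (startGrad ℓ ξ A η s x₀ t i) :=
    (hg i).comp (((measurable_clientModel hg t i).mono (history_le hξ hA t) le_rfl).prodMk (hξ i t))
  refine (h0.norm.add (hX.norm.const_mul (L i : ℝ))).mono' hm.aestronglyMeasurable
    (ae_of_all _ fun ω => ?_)
  have h1 := (hlip i (ξ i t ω)).norm_sub_le (clientModel ℓ ξ A η s x₀ t i ω) 0
  have h2 := norm_le_norm_add_norm_sub (stochGrad (ℓ i) (ξ i t ω) 0)
    (startGrad ℓ ξ A η s x₀ t i ω)
  rw [norm_sub_rev, startGrad] at h2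
  simp only [sub_zero] at h1
  simp only [Pi.add_apply]
  rw [startGrad]
  linarith

theorem memLp_localModel (hη : 0 < η) (hξ : ∀ i t, Measurable (ξ i t))
    (hA : ∀ t, Measurable[_, ⊤] (A t))
    (hg : ∀ i, Measurable fun p : EuclideanSpace ℝ (Fin d) × Ξ i => stochGrad (ℓ i) p.2 p.1)
    (hlip : ∀ i z, LipschitzWith (L i) (stochGrad (ℓ i) z)) {t : ℕ} {i : Fin m}
    (h0 : MemLp (fun ω => stochGrad (ℓ i) (ξ i t ω) 0) 2 P)
    (hX : MemLp (clientModel ℓ ξ A η s x₀ t i) 2 P) :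
    MemLp (localModel ℓ ξ A η s x₀ t i) 2 P := by
  have hm : Measurable (localModel ℓ ξ A η s x₀ t i) := (measurable_localModel hg t i).mono
    (sup_le (history_le hξ hA t) (sampleSigma_le hξ t)) le_rfl
  refine (hX.norm.add ((memLp_startGrad hξ hA hg hlip h0 hX).norm.const_mul
    (η * (s + drift L η s)))).mono' hm.aestronglyMeasurable (ae_of_all _ fun ω => ?_)
  rw [localModel_eq]
  refine (norm_sub_le _ _).trans ?_
  rw [norm_smul, Real.norm_of_nonneg hη.le]
  simp only [Pi.add_apply, mul_assoc]
  gcongr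
  exact norm_roundGrad_le hη hlip t i ω

/-- Lipschitz gradients grow at most linearly, so second moments propagate from round to round,
starting from the gradients at 0. The final time T is included, as it involves only samples of
earlier rounds. -/
theorem memLp_clientModel [IsProbabilityMeasure P] (hη : 0 < η)
    (hξ : ∀ i t, Measurable (ξ i t))
    (hA : ∀ t, Measurable[_, ⊤] (A t))
    (hg : ∀ i, Measurable fun p : EuclideanSpace ℝ (Fin d) × Ξ i => stochGrad (ℓ i) p.2 p.1)
    (hlip : ∀ i z, LipschitzWith (L i) (stochGrad (ℓ i) z)) {T : ℕ}
    (h0 : ∀ t < T, ∀ i, MemLp (fun ω => stochGrad (ℓ i) (ξ i t ω) 0) 2 P)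
    (t : ℕ) (ht : t ≤ T) (i : Fin m) :
    MemLp (clientModel ℓ ξ A η s x₀ t i) 2 P := by
  induction t generalizing i with
  | zero => exact memLp_const x₀
  | succ t ih =>
    have h : clientModel ℓ ξ A η s x₀ (t + 1) i = fun ω =>
        ∑ j, gossipMatrix (A t ω) i j • localModel ℓ ξ A η s x₀ t j ω :=
      funext fun ω => clientModel_succ t i ω
    rw [h]
    refine memLp_finsetSum _ fun j _ => ?_
    have hl := memLp_localModel hη hξ hA hg hlip (h0 t ht j) (ih (by omega) j)
    have hW : Measurable fun ω => gossipMatrix (A t ω) i j :=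
      (measurable_comp_link (fun S => gossipMatrix S i j) t).mono (hA t).comap_le le_rfl
    refine hl.mono (hW.aestronglyMeasurable.smul hl.1) (ae_of_all _ fun ω => ?_)
    rw [norm_smul]
    exact mul_le_of_le_one_left (norm_nonneg _) (abs_gossipMatrix_le_one _ _ _)

end SquareIntegrable

/-! ### Contraction of the spread -/

section Consensus

variable {m d : ℕ} {Ξ : Fin m → Type*}
  {ℓ : (i : Fin m) → EuclideanSpace ℝ (Fin d) → Ξ i → ℝ}
  {Ω : Type*} {ξ : (i : Fin m) → ℕ → Ω → Ξ i} {A : ℕ → Ω → Finset (Fin m)}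
  {η : ℝ} {s : ℕ} {x₀ : EuclideanSpace ℝ (Fin d)}
  [∀ i, MeasurableSpace (Ξ i)] [MeasurableSpace Ω] {P : Measure Ω}

theorem memLp_mean {X : Fin m → Ω → EuclideanSpace ℝ (Fin d)} (h : ∀ i, MemLp (X i) 2 P) :
    MemLp (fun ω => mean fun i => X i ω) 2 P :=
  (memLp_finsetSum _ fun i _ => h i).const_smul (1 / (m : ℝ))

theorem integrable_avgSq {X : Fin m → Ω → EuclideanSpace ℝ (Fin d)} (h : ∀ i, MemLp (X i) 2 P) :
    Integrable (fun ω => avgSq fun i => X i ω) P :=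
  (integrable_finsetSum _ fun i _ => (h i).integrable_norm_pow two_ne_zero).const_mul _

theorem integrable_spread {X : Fin m → Ω → EuclideanSpace ℝ (Fin d)} (h : ∀ i, MemLp (X i) 2 P) :
    Integrable (fun ω => spread fun i => X i ω) P :=
  integrable_avgSq (X := fun i ω => X i ω - mean fun i => X i ω)
    fun i => (h i).sub (memLp_mean h)

variable [IsProbabilityMeasure P]

theorem integral_gossip_sq_mul {m : ℕ} {Ω : Type*} {𝓗 mΩ : MeasurableSpace Ω} {P : Measure Ω}
    {A : ℕ → Ω → Finset (Fin m)} (hA : ∀ t, Measurable[_, ⊤] (A t)) {t : ℕ}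
    (h𝓗 : 𝓗 ≤ mΩ) (hind : Indep (linkSigma A t) 𝓗 P)
    {Z : Ω → ℝ} (hZ : Measurable[𝓗] Z) (j k : Fin m) :
    ∫ ω, (gossipMatrix (A t ω) ^ 2) j k * Z ω ∂P = meanSqGossip P A t j k * ∫ ω, Z ω ∂P := by
  have hW : Measurable[linkSigma A t] fun ω => (gossipMatrix (A t ω) ^ 2) j k :=
    measurable_comp_link (fun S => (gossipMatrix S ^ 2) j k) t
  have hI : IndepFun (fun ω => (gossipMatrix (A t ω) ^ 2) j k) Z P :=
    (IndepFun_iff_Indep _ _ _).2 (indep_of_indep_of_le_left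
      (indep_of_indep_of_le_right hind hZ.comap_le) hW.comap_le)
  exact hI.integral_fun_mul_eq_mul_integral (hW.mono (hA t).comap_le le_rfl).aestronglyMeasurable
    (hZ.mono h𝓗 le_rfl).aestronglyMeasurable

theorem integrable_comp_link (hA : ∀ t, Measurable[_, ⊤] (A t)) (f : Finset (Fin m) → ℝ) (t : ℕ) :
    Integrable (fun ω => f (A t ω)) P := by
  obtain ⟨C, hC⟩ := (Set.finite_range fun S => |f S|).bddAbove
  exact Integrable.of_bound
    ((measurable_comp_link f t).mono (hA t).comap_le le_rfl).aestronglyMeasurable C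
    (ae_of_all _ fun ω => hC ⟨A t ω, rfl⟩)

theorem sum_meanSqGossip (hA : ∀ t, Measurable[_, ⊤] (A t)) (t : ℕ) (i : Fin m) :
    ∑ j, meanSqGossip P A t i j = 1 := by
  simp only [meanSqGossip, Matrix.of_apply]
  rw [← integral_finsetSum _ fun j _ =>
    integrable_comp_link hA (fun S => (gossipMatrix S ^ 2) i j) t]
  simp [sum_gossipMatrix_sq]

theorem integrable_gossip_sq_mul (hA : ∀ t, Measurable[_, ⊤] (A t)) {t : ℕ}
    {Z : Ω → ℝ} (hZ : Integrable Z P) (j k : Fin m) :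
    Integrable (fun ω => (gossipMatrix (A t ω) ^ 2) j k * Z ω) P := by
  obtain ⟨C, hC⟩ := (Set.finite_range fun S : Finset (Fin m) => |(gossipMatrix S ^ 2) j k|).bddAbove
  exact hZ.bdd_mul (integrable_comp_link hA (fun S => (gossipMatrix S ^ 2) j k) t).1
    (ae_of_all _ fun ω => hC ⟨A t ω, rfl⟩)

/-- Averaging over the active uplinks contracts the expected spread by the second eigenvalue of the
mean squared gossip matrix. -/
theorem integral_spread_succ_le (hm : 2 ≤ m) (hξ : ∀ i t, Measurable (ξ i t))
    (hA : ∀ t, Measurable[_, ⊤] (A t))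
    (hg : ∀ i, Measurable fun p : EuclideanSpace ℝ (Fin d) × Ξ i => stochGrad (ℓ i) p.2 p.1)
    {t : ℕ} (hind : Indep (linkSigma A t) (history ξ A t ⊔ sampleSigma ξ t) P)
    (hl2 : lambda2 hm (meanSqGossip_isHermitian P A t) < 1)
    (hY : ∀ i, MemLp (localModel ℓ ξ A η s x₀ t i) 2 P) :
    ∫ ω, spread (fun i => clientModel ℓ ξ A η s x₀ (t + 1) i ω) ∂P
      ≤ lambda2 hm (meanSqGossip_isHermitian P A t) *
        ∫ ω, spread (fun i => localModel ℓ ξ A η s x₀ t i ω) ∂P := by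
  have hm0 : 0 < m := by omega
  set Y : Fin m → Ω → EuclideanSpace ℝ (Fin d) := fun i ω =>
    localModel ℓ ξ A η s x₀ t i ω - mean fun i => localModel ℓ ξ A η s x₀ t i ω with hYdef
  have hY2 : ∀ i, MemLp (Y i) 2 P := fun i => (hY i).sub (memLp_mean hY)
  have hYm : ∀ i, Measurable[history ξ A t ⊔ sampleSigma ξ t] (Y i) := fun i =>
    (measurable_localModel hg t i).sub
      ((Finset.measurable_sum _ fun j _ => measurable_localModel hg t j).const_smul (1 / (m : ℝ)))
  have hle : history ξ A t ⊔ sampleSigma ξ t ≤ ‹MeasurableSpace Ω› :=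
    sup_le (history_le hξ hA t) (sampleSigma_le hξ t)
  have h1 : ∀ ω, spread (fun i => clientModel ℓ ξ A η s x₀ (t + 1) i ω)
      = (1 / (m : ℝ)) * ∑ j, ∑ k, (gossipMatrix (A t ω) ^ 2) j k * inner ℝ (Y j ω) (Y k ω) := by
    intro ω
    simp only [clientModel_succ, spread, mean_gossip, gossip_sub_mean]
    rw [avgSq, sum_norm_sq_gossip]
  have hinner : ∀ j k, Integrable (fun ω => inner ℝ (Y j ω) (Y k ω)) P := fun j k =>
    integrable_inner_of_memLp (hY2 j) (hY2 k)
  have hinnerm : ∀ j k, Measurable[history ξ A t ⊔ sampleSigma ξ t]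
      (fun ω => inner ℝ (Y j ω) (Y k ω)) := fun j k => (hYm j).inner (hYm k)
  calc ∫ ω, spread (fun i => clientModel ℓ ξ A η s x₀ (t + 1) i ω) ∂P
      = (1 / (m : ℝ)) * ∑ j, ∑ k, meanSqGossip P A t j k * ∫ ω, inner ℝ (Y j ω) (Y k ω) ∂P := by
        simp only [h1]
        rw [integral_const_mul, integral_finsetSum _ fun j _ => integrable_finsetSum _ fun k _ =>
          integrable_gossip_sq_mul hA (hinner j k) j k]
        congr 1
        refine Finset.sum_congr rfl fun j _ => ?_
        rw [integral_finsetSum _ fun k _ => integrable_gossip_sq_mul hA (hinner j k) j k]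
        exact Finset.sum_congr rfl fun k _ => integral_gossip_sq_mul hA hle hind (hinnerm j k) j k
    -- The matrix is now deterministic, so the sum returns under the integral and the spectral bound
    -- applies for each outcome.
    _ = (1 / (m : ℝ)) * ∫ ω, ∑ j, ∑ k, meanSqGossip P A t j k * inner ℝ (Y j ω) (Y k ω) ∂P := by
        rw [integral_finsetSum _ fun j _ => integrable_finsetSum _ fun k _ =>
          (hinner j k).const_mul (meanSqGossip P A t j k)]
        congr 1
        refine Finset.sum_congr rfl fun j _ => ?_
        rw [integral_finsetSum _ fun k _ => (hinner j k).const_mul (meanSqGossip P A t j k)]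
        exact Finset.sum_congr rfl fun k _ => (integral_const_mul _ _).symm
    _ ≤ (1 / (m : ℝ)) * ∫ ω, lambda2 hm (meanSqGossip_isHermitian P A t) *
          ∑ i, ‖Y i ω‖ ^ 2 ∂P := by
        gcongr
        · exact integrable_finsetSum _ fun j _ => integrable_finsetSum _ fun k _ =>
            (hinner j k).const_mul _
        · exact (integrable_finsetSum _ fun i _ =>
            (hY2 i).integrable_norm_pow two_ne_zero).const_mul _
        · intro ω
          exact sum_inner_le_lambda2 hm _ (sum_meanSqGossip hA t) hl2 (fun i => Y i ω)
            (sum_sub_mean hm0 _)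
    _ = lambda2 hm (meanSqGossip_isHermitian P A t) *
        ∫ ω, spread (fun i => localModel ℓ ξ A η s x₀ t i ω) ∂P := by
        simp only [spread, avgSq]
        rw [integral_const_mul, integral_const_mul]
        ring

end Consensus

/-! ### Second moments of the gradients and descent -/

section Gradients

variable {m d : ℕ}

theorem avgSq_comp_sub_le {K : ℝ≥0}
    {H : Fin m → EuclideanSpace ℝ (Fin d) → EuclideanSpace ℝ (Fin d)}
    (hH : ∀ i, LipschitzWith K (H i)) (x : Fin m → EuclideanSpace ℝ (Fin d)) :
    avgSq (fun i => H i (x i) - H i (mean x)) ≤ (K : ℝ) ^ 2 * spread x := by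
  refine (avgSq_le_of_le (y := fun i => (K : ℝ) ^ 2 * ‖x i - mean x‖ ^ 2) fun i => ?_).trans_eq ?_
  · rw [← mul_pow]
    exact pow_le_pow_left₀ (norm_nonneg _) ((hH i).norm_sub_le _ _) 2
  · rw [← Finset.mul_sum, spread, avgSq]
    ring

/-- Each H_i(x_i) is split at the common point, the mean. The difference costs spread by the
Lipschitz bound; at the common point the average of squares is the squared mean plus the
dissimilarity. -/
theorem avgSq_comp_le (hm : 0 < m) {K : ℝ≥0}
    {H : Fin m → EuclideanSpace ℝ (Fin d) → EuclideanSpace ℝ (Fin d)}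
    (hH : ∀ i, LipschitzWith K (H i)) {β ζ : ℝ}
    (hdis : ∀ x, spread (fun i => H i x) ≤ β ^ 2 * ‖mean fun i => H i x‖ ^ 2 + ζ ^ 2)
    (x : Fin m → EuclideanSpace ℝ (Fin d)) :
    avgSq (fun i => H i (x i))
      ≤ 2 * (K : ℝ) ^ 2 * spread x + 2 * (β ^ 2 + 1) * ‖mean fun i => H i (mean x)‖ ^ 2
        + 2 * ζ ^ 2 := by
  have h1 := avgSq_comp_sub_le hH x
  have h2 := hdis (mean x)
  rw [spread_eq hm] at h2
  have h3 : avgSq (fun i => H i (x i)) ≤ 2 * avgSq (fun i => H i (x i) - H i (mean x))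
      + 2 * avgSq (fun i => H i (mean x)) := by
    refine (avgSq_le_of_le (y := fun i => 2 * ‖H i (x i) - H i (mean x)‖ ^ 2
      + 2 * ‖H i (mean x)‖ ^ 2) fun i => ?_).trans_eq ?_
    · have h := norm_add_le (H i (x i) - H i (mean x)) (H i (mean x))
      rw [sub_add_cancel] at h
      nlinarith [sq_nonneg (‖H i (x i) - H i (mean x)‖ - ‖H i (mean x)‖),
        norm_nonneg (H i (x i))]
    · rw [Finset.sum_add_distrib, ← Finset.mul_sum, ← Finset.mul_sum, avgSq, avgSq]
      ring
  linarith

variable {Ω : Type*} {𝓖 mΩ : MeasurableSpace Ω} {P : Measure Ω} [IsProbabilityMeasure P]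

theorem memLp_comp_lipschitz {K : ℝ≥0} {H : EuclideanSpace ℝ (Fin d) → EuclideanSpace ℝ (Fin d)}
    (hH : LipschitzWith K H) {X : Ω → EuclideanSpace ℝ (Fin d)} (hX : MemLp X 2 P) :
    MemLp (fun ω => H (X ω)) 2 P := by
  refine ((memLp_const ‖H 0‖).add (hX.norm.const_mul (K : ℝ))).mono'
    (hH.continuous.comp_aestronglyMeasurable hX.1) (ae_of_all _ fun ω => ?_)
  have h1 := hH.norm_sub_le (X ω) 0
  have h2 := norm_le_norm_add_norm_sub (H 0) (H (X ω))
  rw [norm_sub_rev] at h2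
  simp only [sub_zero] at h1
  simp only [Pi.add_apply]
  linarith

theorem integrable_comp_of_lipschitz_gradient {F : EuclideanSpace ℝ (Fin d) → ℝ}
    (hF : Differentiable ℝ F) {K : ℝ≥0} (hK : LipschitzWith K (∇ F))
    {X : Ω → EuclideanSpace ℝ (Fin d)} (hX : MemLp X 2 P) :
    Integrable (fun ω => F (X ω)) P := by
  refine (((integrable_const |F 0|).add ((hX.norm.integrable one_le_two).const_mul ‖∇ F 0‖)).add
    ((hX.integrable_norm_pow two_ne_zero).const_mul (K : ℝ))).mono'
    (hF.continuous.comp_aestronglyMeasurable hX.1) (ae_of_all _ fun ω => ?_)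
  have h1 := abs_sub_inner_gradient_le hF hK 0 (X ω)
  have h2 := abs_real_inner_le_norm (∇ F 0) (X ω)
  rw [sub_zero] at h1
  simp only [Pi.add_apply, Real.norm_eq_abs]
  rw [abs_le] at *
  have h3 := neg_abs_le (F 0)
  have h4 := le_abs_self (F 0)
  constructor <;> linarith

/-- A second moment is at most the conditional variance plus the second moment of the conditional
mean. -/
theorem integral_norm_sq_le_of_condExp (h𝓖 : 𝓖 ≤ mΩ) {g h : Ω → EuclideanSpace ℝ (Fin d)}
    (hg : MemLp g 2 P) (hh : MemLp h 2 P) (hhm : StronglyMeasurable[𝓖] h)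
    (hgh : P[g | 𝓖] =ᵐ[P] h) {C : ℝ} (hC : ∫ ω, ‖g ω - h ω‖ ^ 2 ∂P ≤ C) :
    ∫ ω, ‖g ω‖ ^ 2 ∂P ≤ C + ∫ ω, ‖h ω‖ ^ 2 ∂P := by
  have h1 := integral_inner_eq_of_condExp h𝓖 hhm hh hg hgh
  simp only [real_inner_self_eq_norm_sq] at h1
  have hg2 := hg.integrable_norm_pow two_ne_zero
  have hh2 := hh.integrable_norm_pow two_ne_zero
  have hin := (integrable_inner_of_memLp hh hg).const_mul 2
  have h2 : ∫ ω, ‖g ω - h ω‖ ^ 2 ∂P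
      = ∫ ω, ‖g ω‖ ^ 2 ∂P - 2 * ∫ ω, inner ℝ (h ω) (g ω) ∂P + ∫ ω, ‖h ω‖ ^ 2 ∂P := by
    have hpt : (fun ω => ‖g ω - h ω‖ ^ 2) = ((fun ω => ‖g ω‖ ^ 2)
        - fun ω => 2 * inner ℝ (h ω) (g ω)) + fun ω => ‖h ω‖ ^ 2 := by
      ext ω
      simp only [norm_sub_sq_real, Pi.add_apply, Pi.sub_apply, real_inner_comm]
    rw [hpt, integral_add' (hg2.sub hin) hh2, integral_sub' hg2 hin, integral_const_mul]
  linarith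

theorem integral_avgSq_le (hm : 0 < m) (h𝓖 : 𝓖 ≤ mΩ) {K : ℝ≥0}
    {H : Fin m → EuclideanSpace ℝ (Fin d) → EuclideanSpace ℝ (Fin d)}
    (hH : ∀ i, LipschitzWith K (H i)) {β ζ σ : ℝ}
    (hdis : ∀ x, spread (fun i => H i x) ≤ β ^ 2 * ‖mean fun i => H i x‖ ^ 2 + ζ ^ 2)
    {X g : Fin m → Ω → EuclideanSpace ℝ (Fin d)} (hXm : ∀ i, Measurable[𝓖] (X i))
    (hX : ∀ i, MemLp (X i) 2 P) (hg : ∀ i, MemLp (g i) 2 P)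
    (hunb : ∀ i, P[g i | 𝓖] =ᵐ[P] fun ω => H i (X i ω))
    (hvar : ∀ i, ∫ ω, ‖g i ω - H i (X i ω)‖ ^ 2 ∂P ≤ σ ^ 2) :
    ∫ ω, avgSq (fun i => g i ω) ∂P
      ≤ σ ^ 2 + 2 * (K : ℝ) ^ 2 * ∫ ω, spread (fun i => X i ω) ∂P
        + 2 * (β ^ 2 + 1) * ∫ ω, ‖mean fun i => H i (mean fun j => X j ω)‖ ^ 2 ∂P
        + 2 * ζ ^ 2 := by
  have hm' : (0 : ℝ) < m := by exact_mod_cast hm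
  have hHX : ∀ i, MemLp (fun ω => H i (X i ω)) 2 P := fun i => memLp_comp_lipschitz (hH i) (hX i)
  have h1 : ∫ ω, avgSq (fun i => g i ω) ∂P ≤ σ ^ 2 + ∫ ω, avgSq (fun i => H i (X i ω)) ∂P := by
    simp only [avgSq]
    rw [integral_const_mul, integral_const_mul,
      integral_finsetSum _ fun i _ => (hg i).integrable_norm_pow two_ne_zero,
      integral_finsetSum _ fun i _ => (hHX i).integrable_norm_pow two_ne_zero]
    have : ∑ i, ∫ ω, ‖g i ω‖ ^ 2 ∂P ≤ ∑ i, (σ ^ 2 + ∫ ω, ‖H i (X i ω)‖ ^ 2 ∂P) :=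
      Finset.sum_le_sum fun i _ => integral_norm_sq_le_of_condExp h𝓖 (hg i) (hHX i)
        ((hH i).continuous.measurable.comp (hXm i)).stronglyMeasurable (hunb i) (hvar i)
    refine (mul_le_mul_of_nonneg_left this (by positivity)).trans_eq ?_
    rw [Finset.sum_add_distrib]
    simp
    field_simp
  have hHm : MemLp (fun ω => mean fun i => H i (mean fun j => X j ω)) 2 P :=
    memLp_mean fun i => memLp_comp_lipschitz (hH i) (memLp_mean hX)
  have hi1 := (integrable_spread hX).const_mul (2 * (K : ℝ) ^ 2)
  have hi2 := (hHm.integrable_norm_pow two_ne_zero).const_mul (2 * (β ^ 2 + 1))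
  have h2 : ∫ ω, avgSq (fun i => H i (X i ω)) ∂P
      ≤ 2 * (K : ℝ) ^ 2 * ∫ ω, spread (fun i => X i ω) ∂P
        + 2 * (β ^ 2 + 1) * ∫ ω, ‖mean fun i => H i (mean fun j => X j ω)‖ ^ 2 ∂P
        + 2 * ζ ^ 2 := by
    have h3 := integral_mono (integrable_avgSq hHX)
      ((hi1.add hi2).add (integrable_const (2 * ζ ^ 2)))
      fun ω => avgSq_comp_le hm hH hdis fun i => X i ω
    refine h3.trans_eq ?_
    rw [integral_add' (hi1.add hi2) (integrable_const _), integral_add' hi1 hi2,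
      integral_const_mul, integral_const_mul]
    simp
  linarith

theorem norm_mean_sub_smul_mean_sq_le (hm : 0 < m) {E : Type*} [NormedAddCommGroup E]
    [InnerProductSpace ℝ E] {g G : Fin m → E} {c δ : ℝ}
    (hG : ∀ i, ‖G i - c • g i‖ ≤ δ * ‖g i‖) :
    ‖mean G - c • mean g‖ ^ 2 ≤ δ ^ 2 * avgSq g := by
  rw [← mean_smul, ← mean_sub]
  refine (norm_mean_sq_le hm _).trans
    ((avgSq_le_of_le (y := fun i => δ ^ 2 * ‖g i‖ ^ 2) fun i => ?_).trans_eq ?_)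
  · rw [← mul_pow]
    exact pow_le_pow_left₀ (norm_nonneg _) (hG i) 2
  · rw [← Finset.mul_sum, avgSq]
    ring

theorem avgSq_le_mul_avgSq {E : Type*} [NormedAddCommGroup E] {g G : Fin m → E} {c : ℝ}
    (hG : ∀ i, ‖G i‖ ≤ c * ‖g i‖) : avgSq G ≤ c ^ 2 * avgSq g := by
  refine (avgSq_le_of_le (y := fun i => c ^ 2 * ‖g i‖ ^ 2) fun i => ?_).trans_eq ?_
  · rw [← mul_pow]
    exact pow_le_pow_left₀ (norm_nonneg _) (hG i) 2
  · rw [← Finset.mul_sum, avgSq]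
    ring

theorem inner_mean {E : Type*} [NormedAddCommGroup E] [InnerProductSpace ℝ E] (a : E)
    (x : Fin m → E) : inner ℝ a (mean x) = (1 / (m : ℝ)) * ∑ i, inner ℝ a (x i) := by
  rw [mean, real_inner_smul_right, inner_sum]

/-- Expected decrease of a smooth objective in one round. -/
theorem integral_descent (hm : 0 < m) (h𝓖 : 𝓖 ≤ mΩ) {F : EuclideanSpace ℝ (Fin d) → ℝ}
    (hF : Differentiable ℝ F) {K : ℝ≥0} (hFK : LipschitzWith K (∇ F))
    {H : Fin m → EuclideanSpace ℝ (Fin d) → EuclideanSpace ℝ (Fin d)}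
    (hH : ∀ i, LipschitzWith K (H i)) (hFH : ∀ x, ∇ F x = mean fun i => H i x)
    {X g G : Fin m → Ω → EuclideanSpace ℝ (Fin d)} (hXm : ∀ i, Measurable[𝓖] (X i))
    (hX : ∀ i, MemLp (X i) 2 P) (hg : ∀ i, MemLp (g i) 2 P)
    (hunb : ∀ i, P[g i | 𝓖] =ᵐ[P] fun ω => H i (X i ω))
    {η s δ : ℝ} (hη : 0 < η) (hs : 0 < s)
    (hG : ∀ i ω, ‖G i ω - s • g i ω‖ ≤ δ * ‖g i ω‖)
    (hG' : ∀ i ω, ‖G i ω‖ ≤ (s + δ) * ‖g i ω‖)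
    (hnext : MemLp (fun ω => (mean fun i => X i ω) - η • mean fun i => G i ω) 2 P) :
    ∫ ω, F ((mean fun i => X i ω) - η • mean fun i => G i ω) ∂P
      ≤ ∫ ω, F (mean fun i => X i ω) ∂P
        - 3 / 8 * (η * s) * ∫ ω, ‖∇ F (mean fun i => X i ω)‖ ^ 2 ∂P
        + η * s / 2 * (K : ℝ) ^ 2 * ∫ ω, spread (fun i => X i ω) ∂P
        + (2 * η / s * δ ^ 2 + K * η ^ 2 * (s + δ) ^ 2) * ∫ ω, avgSq (fun i => g i ω) ∂P := by
  have hm' : (0 : ℝ) < m := by exact_mod_cast hm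
  have hHX : ∀ i, MemLp (fun ω => H i (X i ω)) 2 P := fun i => memLp_comp_lipschitz (hH i) (hX i)
  have hbar := memLp_mean hX
  have hgrad : MemLp (fun ω => ∇ F (mean fun i => X i ω)) 2 P := memLp_comp_lipschitz hFK hbar
  have hgradm : StronglyMeasurable[𝓖] fun ω => ∇ F (mean fun i => X i ω) := by
    refine Measurable.stronglyMeasurable (hFK.continuous.measurable.comp ?_)
    exact (Finset.measurable_sum _ fun i _ => hXm i).const_smul (1 / (m : ℝ))
  -- The gradient at the average is known before the round, so unbiasedness may be applied to its
  -- product with the first gradients.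
  have hcross : ∫ ω, inner ℝ (∇ F (mean fun i => X i ω)) (mean fun i => g i ω) ∂P
      = ∫ ω, inner ℝ (∇ F (mean fun i => X i ω)) (mean fun i => H i (X i ω)) ∂P := by
    simp only [inner_mean]
    rw [integral_const_mul, integral_const_mul,
      integral_finsetSum _ fun i _ => integrable_inner_of_memLp hgrad (hg i),
      integral_finsetSum _ fun i _ => integrable_inner_of_memLp hgrad (hHX i)]
    congr 1
    exact Finset.sum_congr rfl fun i _ =>
      integral_inner_eq_of_condExp h𝓖 hgradm hgrad (hg i) (hunb i)
  have hpt : ∀ ω, F ((mean fun i => X i ω) - η • mean fun i => G i ω)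
      ≤ F (mean fun i => X i ω)
        - η * s * inner ℝ (∇ F (mean fun i => X i ω)) (mean fun i => g i ω)
        + η * s / 8 * ‖∇ F (mean fun i => X i ω)‖ ^ 2
        + (2 * η / s * δ ^ 2 + K * η ^ 2 * (s + δ) ^ 2) * avgSq (fun i => g i ω) := by
    intro ω
    set x := mean fun i => X i ω
    set Gb := mean fun i => G i ω
    set gb := mean fun i => g i ω
    have h1 := (abs_le.1 (abs_sub_inner_gradient_le hF hFK x (x - η • Gb))).2
    rw [sub_sub_cancel_left, inner_neg_right, real_inner_smul_right, norm_neg, norm_smul,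
      mul_pow, Real.norm_eq_abs, sq_abs] at h1
    have h2 : ‖Gb‖ ^ 2 ≤ (s + δ) ^ 2 * avgSq (fun i => g i ω) :=
      (norm_mean_sq_le hm _).trans (avgSq_le_mul_avgSq fun i => hG' i ω)
    have h3 := norm_mean_sub_smul_mean_sq_le hm (fun i => hG i ω)
    have h4 : inner ℝ (∇ F x) Gb = s * inner ℝ (∇ F x) gb + inner ℝ (∇ F x) (Gb - s • gb) := by
      rw [inner_sub_right, real_inner_smul_right]; ring
    have h5 := (abs_le.1 (abs_real_inner_le_norm (∇ F x) (Gb - s • gb))).1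
    -- The weight s/8 is chosen so that, against the s/2 gained from the main term, 3s/8 survives.
    have h6 : ‖∇ F x‖ * ‖Gb - s • gb‖ ≤ s / 8 * ‖∇ F x‖ ^ 2 + 2 / s * ‖Gb - s • gb‖ ^ 2 := by
      have : s / 8 * ‖∇ F x‖ ^ 2 + 2 / s * ‖Gb - s • gb‖ ^ 2 - ‖∇ F x‖ * ‖Gb - s • gb‖
          = 1 / (8 * s) * (s * ‖∇ F x‖ - 4 * ‖Gb - s • gb‖) ^ 2 := by
        field_simp
        ring
      have h : 0 ≤ 1 / (8 * s) * (s * ‖∇ F x‖ - 4 * ‖Gb - s • gb‖) ^ 2 := by positivity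
      linarith
    have h7 : 2 / s * ‖Gb - s • gb‖ ^ 2 ≤ 2 / s * (δ ^ 2 * avgSq (fun i => g i ω)) := by gcongr
    have h8 : -inner ℝ (∇ F x) (Gb - s • gb)
        ≤ s / 8 * ‖∇ F x‖ ^ 2 + 2 / s * (δ ^ 2 * avgSq (fun i => g i ω)) := by linarith
    have h9 := mul_le_mul_of_nonneg_left h8 hη.le
    have h10 : (K : ℝ) * (η ^ 2 * ‖Gb‖ ^ 2)
        ≤ K * (η ^ 2 * ((s + δ) ^ 2 * avgSq (fun i => g i ω))) := by gcongr
    rw [h4] at h1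
    calc F (x - η • Gb) ≤ F x - η * s * inner ℝ (∇ F x) gb
          + η * (-inner ℝ (∇ F x) (Gb - s • gb)) + K * (η ^ 2 * ‖Gb‖ ^ 2) := by linarith
      _ ≤ F x - η * s * inner ℝ (∇ F x) gb
          + η * (s / 8 * ‖∇ F x‖ ^ 2 + 2 / s * (δ ^ 2 * avgSq (fun i => g i ω)))
          + K * (η ^ 2 * ((s + δ) ^ 2 * avgSq (fun i => g i ω))) := by linarith
      _ = _ := by ring
  -- Polarization: expand ‖mean H_i(x_i) − ∇F(x̄)‖² ≤ K² · spread and discard ‖mean H_i(x_i)‖².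
  have hpt2 : ∀ ω, -inner ℝ (∇ F (mean fun i => X i ω)) (mean fun i => H i (X i ω))
      ≤ -(1 / 2) * ‖∇ F (mean fun i => X i ω)‖ ^ 2
        + (K : ℝ) ^ 2 / 2 * spread (fun i => X i ω) := by
    intro ω
    have h1 := (norm_mean_sq_le hm _).trans (avgSq_comp_sub_le hH fun i => X i ω)
    rw [mean_sub, ← hFH, norm_sub_sq_real, real_inner_comm] at h1
    nlinarith [sq_nonneg ‖mean fun i => H i (X i ω)‖]
  have i1 := integrable_comp_of_lipschitz_gradient hF hFK hbar
  have i2 := (integrable_inner_of_memLp hgrad (memLp_mean hg)).const_mul (η * s)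
  have i3 := hgrad.integrable_norm_pow two_ne_zero
  have i4 := (integrable_avgSq hg).const_mul (2 * η / s * δ ^ 2 + K * η ^ 2 * (s + δ) ^ 2)
  have h1 := integral_mono (integrable_comp_of_lipschitz_gradient hF hFK hnext)
    (((i1.sub i2).add (i3.const_mul (η * s / 8))).add i4) hpt
  rw [integral_add' ((i1.sub i2).add (i3.const_mul (η * s / 8))) i4,
    integral_add' (i1.sub i2) (i3.const_mul (η * s / 8)), integral_sub' i1 i2,
    integral_const_mul, integral_const_mul, integral_const_mul, hcross] at h1
  have h2 := integral_mono (integrable_inner_of_memLp hgrad (memLp_mean hHX)).neg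
    ((i3.const_mul (-(1 / 2))).add ((integrable_spread hX).const_mul ((K : ℝ) ^ 2 / 2))) hpt2
  rw [integral_neg', integral_add' (i3.const_mul (-(1 / 2)))
    ((integrable_spread hX).const_mul ((K : ℝ) ^ 2 / 2)), integral_const_mul,
    integral_const_mul] at h2
  have h3 := mul_le_mul_of_nonneg_left h2 (mul_pos hη hs).le
  linarith

end Gradients

/-! ### Summation over the rounds and closing the linear system -/

/-- The bound on the accumulated squared gradient norms `SA`, obtained from the accumulated
estimates of the second moments `SU` of the stochastic gradients, of the spreads `SD` and of the
decrease `Δ` of the objective. -/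
theorem sum_gradient_bound {K s κ η c B δ SA SD SU Δ N M : ℝ} (hK : 1 ≤ K) (hs : 1 ≤ s)
    (hη : 0 < η) (hc0 : 0 < c) (hc1 : c ≤ 1) (hB : 1 ≤ B) (hδ0 : 0 ≤ δ)
    (hδ : δ ≤ κ * (s ^ 2 / 2) * η * K)
    (hηc : η * (108 * K ^ 2 * s ^ 3 * B * (1 + κ ^ 2 * K ^ 2)) ≤ c)
    (hSA : 0 ≤ SA) (hSU : 0 ≤ SU) (hΔ : 0 ≤ Δ) (hM : 0 ≤ M) (hN : N ≤ 2 * M)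
    (h1 : SU ≤ N + 2 * K ^ 2 * SD + 2 * B * SA)
    (h2 : c * SD ≤ 1 / c * (η ^ 2 * ((s + δ) ^ 2 * SU)))
    (h3 : 0 ≤ Δ - 3 / 8 * (η * s) * SA + η * s / 2 * K ^ 2 * SD
      + (2 * η / s * δ ^ 2 + K * η ^ 2 * (s + δ) ^ 2) * SU) :
    SA ≤ 6 * Δ / (η * s) + 54 * η * s * K * (κ ^ 2 * K ^ 2 + 1 + 1 / c) * M := by
  have hK0 : 0 < K := by linarith
  have hs0 : 0 < s := by linarith
  have hB0 : 0 < B := by linarith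
  -- Everything is expressed through e, w and p = w/c. The learning rate condition makes wB, ewB and
  -- pB at most 1/108, after which the estimates are nearly linear.
  obtain ⟨e, he⟩ : ∃ e, e = κ ^ 2 * K ^ 2 := ⟨_, rfl⟩
  obtain ⟨w, hw⟩ : ∃ w, w = η * s * K := ⟨_, rfl⟩
  obtain ⟨p, hp⟩ : ∃ p, p = w / c := ⟨_, rfl⟩
  have he0 : 0 ≤ e := by rw [he]; positivity
  have hw0 : 0 < w := by rw [hw]; positivity
  have hp0 : 0 < p := by rw [hp]; positivity
  have hwp : w ≤ p := by
    rw [hp, le_div_iff₀ hc0]; exact mul_le_of_le_one_right hw0.le hc1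
  have hs2 : 1 ≤ s ^ 2 := one_le_pow₀ hs
  have hbig : w * B * (1 + e) * 108 ≤ c := by
    refine le_trans ?_ hηc
    rw [hw, he]
    have : 1 ≤ K * s ^ 2 := one_le_mul_of_one_le_of_one_le hK hs2
    calc η * s * K * B * (1 + κ ^ 2 * K ^ 2) * 108
        = (η * s * K * B * (1 + κ ^ 2 * K ^ 2) * 108) * 1 := by ring
      _ ≤ (η * s * K * B * (1 + κ ^ 2 * K ^ 2) * 108) * (K * s ^ 2) := by gcongr
      _ = _ := by ring
  have hewB0 : 0 ≤ e * w * B := by positivity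
  have hwB0 : 0 < w * B := by positivity
  have hsplit : w * B * (1 + e) * 108 = 108 * (w * B) + 108 * (e * w * B) := by ring
  have hwB : w * B ≤ c / 108 := by linarith
  have hewB : e * w * B ≤ 1 / 108 := by linarith
  have hpB : p * B ≤ 1 / 108 := by
    rw [hp, div_mul_eq_mul_div, div_le_iff₀ hc0]; linarith
  have hp1 : p ≤ 1 / 108 := (le_mul_of_one_le_right hp0.le hB).trans hpB
  have hw1 : w * (1 + e) ≤ 1 / 108 := by
    have : w * (1 + e) ≤ w * (1 + e) * B := le_mul_of_one_le_right (by positivity) hB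
    have h4 : w * (1 + e) * B = w * B + e * w * B := by ring
    linarith
  have hηs : η * s ≤ w := by
    rw [hw]; exact le_mul_of_one_le_right (by positivity) hK
  have hηs0 : 0 < η * s := by positivity
  have hκK : κ * K ≤ 1 + e := by
    have h4 : (κ * K - 1) ^ 2 = e - 2 * (κ * K) + 1 := by rw [he]; ring
    linarith [sq_nonneg (κ * K - 1)]
  have hδs : δ ≤ s / 216 := by
    calc δ ≤ κ * (s ^ 2 / 2) * η * K := hδ
      _ = s / 2 * ((κ * K) * (η * s)) := by ring
      _ ≤ s / 2 * ((1 + e) * w) := by gcongr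
      _ ≤ s / 2 * (1 / 108) := by gcongr; linarith
      _ = s / 216 := by ring
  have hsδ : (s + δ) ^ 2 ≤ 1.1 * s ^ 2 := by
    calc (s + δ) ^ 2 ≤ (s + s / 216) ^ 2 := by gcongr
      _ = (217 / 216) ^ 2 * s ^ 2 := by ring
      _ ≤ 1.1 * s ^ 2 := by gcongr; norm_num
  have hD : K ^ 2 * SD ≤ 1.1 / 108 * p * SU := by
    have h4 : c ^ 2 * SD ≤ η ^ 2 * ((s + δ) ^ 2 * SU) := by
      have := mul_le_mul_of_nonneg_left h2 hc0.le
      calc c ^ 2 * SD = c * (c * SD) := by ring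
        _ ≤ c * (1 / c * (η ^ 2 * ((s + δ) ^ 2 * SU))) := this
        _ = _ := by field_simp
    have h5 : c ^ 2 * (K ^ 2 * SD) ≤ c ^ 2 * (1.1 * p ^ 2 * SU) := by
      calc c ^ 2 * (K ^ 2 * SD) = K ^ 2 * (c ^ 2 * SD) := by ring
        _ ≤ K ^ 2 * (η ^ 2 * ((1.1 * s ^ 2) * SU)) :=
          mul_le_mul_of_nonneg_left (h4.trans (by gcongr)) (sq_nonneg K)
        _ = _ := by rw [hp, hw]; field_simp
    have h6 := le_of_mul_le_mul_left h5 (by positivity)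
    refine h6.trans ?_
    have : 1.1 * p ^ 2 ≤ 1.1 / 108 * p := by
      have := mul_le_mul_of_nonneg_left hp1 hp0.le
      rw [pow_two]
      linarith
    gcongr
  -- Inserting the spread bound into `h1` returns SU with coefficient 2.2/108², which the left side
  -- absorbs.
  have hU : SU ≤ 1.01 * (N + 2 * B * SA) := by
    have : 1.1 / 108 * p * SU ≤ 1.1 / 108 * (1 / 108) * SU := by gcongr
    linarith
  have hdrift : 2 * η / s * δ ^ 2 ≤ η * s * (e * w / 216) := by
    have h4 : δ ^ 2 ≤ (κ * (s ^ 2 / 2) * η * K) ^ 2 := by gcongr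
    calc 2 * η / s * δ ^ 2 ≤ 2 * η / s * (κ * (s ^ 2 / 2) * η * K) ^ 2 := by gcongr
      _ = η * s * (e * ((η * s) * (η * s)) / 2) := by rw [he]; field_simp
      _ ≤ η * s * (e * (w * (1 / 108)) / 2) := by
        gcongr
        linarith
      _ = _ := by ring
  have hquad : K * η ^ 2 * (s + δ) ^ 2 ≤ η * s * (1.1 * w) := by
    calc K * η ^ 2 * (s + δ) ^ 2 ≤ K * η ^ 2 * (1.1 * s ^ 2) := by gcongr
      _ = _ := by rw [hw]; ring
  -- Q is the total coefficient of SU in units of ηs: the contributions of spread, drift and the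
  -- quadratic term.
  obtain ⟨Q, hQ⟩ : ∃ Q, Q = 1.1 / 216 * p + e * w / 216 + 1.1 * w := ⟨_, rfl⟩
  have hQ0 : 0 ≤ Q := by rw [hQ]; positivity
  have hmain : η * s * (3 / 8 * SA) ≤ Δ + η * s * (Q * SU) := by
    have h4 : (2 * η / s * δ ^ 2 + K * η ^ 2 * (s + δ) ^ 2) * SU
        ≤ (η * s * (e * w / 216) + η * s * (1.1 * w)) * SU := by gcongr
    have h5 : η * s / 2 * (K ^ 2 * SD) ≤ η * s / 2 * (1.1 / 108 * p * SU) := by gcongr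
    have h6 : η * s * (Q * SU) = η * s / 2 * (1.1 / 108 * p * SU)
        + (η * s * (e * w / 216) + η * s * (1.1 * w)) * SU := by rw [hQ]; ring
    linarith
  have hmain2 : 3 / 8 * SA ≤ Δ / (η * s) + Q * SU := by
    have h4 : 3 / 8 * SA - Q * SU ≤ Δ / (η * s) := by
      rw [le_div_iff₀ hηs0]; linarith
    linarith
  have hQB : Q * B ≤ 1.12 / 108 := by
    have h4 : Q * B = 1.1 / 216 * (p * B) + e * w * B / 216 + 1.1 * (w * B) := by rw [hQ]; ring
    linarith
  have hQU : Q * SU ≤ 2.02 * (Q * M) + 2.02 * (Q * B) * SA := by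
    have h4 : Q * SU ≤ Q * (1.01 * (2 * M + 2 * B * SA)) := by
      gcongr
      exact hU.trans (by gcongr)
    linarith
  have hQBA : Q * B * SA ≤ 1.12 / 108 * SA := by gcongr
  have hQR : Q ≤ 1.2 * (w * (e + 1 + 1 / c)) := by
    have : w * (e + 1 + 1 / c) = e * w + w + p := by rw [hp]; ring
    rw [this, hQ]
    have : 0 ≤ e * w := by positivity
    linarith
  have hQM : Q * M ≤ 1.2 * (w * (e + 1 + 1 / c)) * M := by gcongr
  have hR : 0 ≤ w * (e + 1 + 1 / c) * M := by positivity
  have hΔ' : 0 ≤ Δ / (η * s) := by positivity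
  -- The surviving coefficient of SA is 3/8 − 2.02 · 1.12/108 > 1/3, so 6 and 54 hold with room to
  -- spare.
  have hfin : SA ≤ 6 * (Δ / (η * s)) + 54 * (w * (e + 1 + 1 / c) * M) := by linarith
  refine hfin.trans_eq ?_
  rw [hw, he]
  ring

/-- Summing the recursion shifts the index by one; `D 0 = 0` makes the shift lossless, and the terms
added at the last index are nonnegative. -/
theorem sum_spread_le {r C : ℝ} {D u : ℕ → ℝ} {T : ℕ} (h0 : D 0 = 0) (hr : 0 ≤ r)
    (hD : ∀ t, 0 ≤ D t) (hu : ∀ t, 0 ≤ C * u t)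
    (h : ∀ t < T, D (t + 1) ≤ r * D t + C * u t) :
    (1 - r) * ∑ t ∈ Finset.range T, D t ≤ C * ∑ t ∈ Finset.range T, u t := by
  rcases T with _ | T
  · simp
  have h1 : ∑ t ∈ Finset.range (T + 1), D t = ∑ t ∈ Finset.range T, D (t + 1) := by
    rw [Finset.sum_range_succ', h0, add_zero]
  have h2 : ∑ t ∈ Finset.range T, D (t + 1) ≤ ∑ t ∈ Finset.range T, (r * D t + C * u t) :=
    Finset.sum_le_sum fun t ht => h t (by rw [Finset.mem_range] at ht; omega)
  have h3 : ∑ t ∈ Finset.range T, (r * D t + C * u t)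
      ≤ ∑ t ∈ Finset.range (T + 1), (r * D t + C * u t) := by
    rw [Finset.sum_range_succ]
    linarith [mul_nonneg hr (hD T), hu T]
  have h4 : ∑ t ∈ Finset.range (T + 1), (r * D t + C * u t)
      = r * ∑ t ∈ Finset.range (T + 1), D t + C * ∑ t ∈ Finset.range (T + 1), u t := by
    rw [Finset.sum_add_distrib, ← Finset.mul_sum, ← Finset.mul_sum]
  linarith

end FedPBC

/-! ### Assembly of the main theorem -/

open FedPBC

set_option maxHeartbeats 1000000 in
theorem mainTheorem1
    {m d : ℕ} (hm : 2 ≤ m)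
    -- the data of the clients: sample spaces, distributions and loss functions
    {Ξ : Fin m → Type*} [∀ i, MeasurableSpace (Ξ i)]
    (D : (i : Fin m) → Measure (Ξ i)) [∀ i, IsProbabilityMeasure (D i)]
    (ℓ : (i : Fin m) → EuclideanSpace ℝ (Fin d) → Ξ i → ℝ)
    (hℓ_meas : ∀ i x, Measurable (ℓ i x))
    (hℓ_int : ∀ i x, Integrable (ℓ i x) (D i))
    -- the randomness: samples `ξ i t` and sets `A t` of active uplinks
    {Ω : Type*} [MeasurableSpace Ω] (P : Measure Ω) [IsProbabilityMeasure P]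
    (ξ : (i : Fin m) → ℕ → Ω → Ξ i) (hξ : ∀ i t, Measurable (ξ i t))
    (A : ℕ → Ω → Finset (Fin m)) (hA : ∀ t, Measurable[_, ⊤] (A t))
    -- parameters of the algorithm: rounds, local steps, learning rate, initial model
    (T s : ℕ) (hT : 1 ≤ T) (hs : 1 ≤ s) (η : ℝ) (hη : 0 < η)
    (x₀ : EuclideanSpace ℝ (Fin d))
    -- the uplinks of a round are independent of the past and of the samples of that round
    (hA_indep : ∀ t < T, Indep (FedPBC.linkSigma A t)
      (FedPBC.history ξ A t ⊔ FedPBC.sampleSigma ξ t) P)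
    -- smoothness
    (L : Fin m → ℝ≥0)
    (hℓ_diff : ∀ i z, Differentiable ℝ (fun x => ℓ i x z))
    (hℓ_lip : ∀ i z, LipschitzWith (L i) (FedPBC.stochGrad (ℓ i) z))
    (hL : 1 ≤ FedPBC.maxLip L)
    -- unbiased stochastic gradients at the start of each round, with bounded variance
    (σ : ℝ)
    (h_unbiased : ∀ t < T, ∀ i,
      P[fun ω => FedPBC.stochGrad (ℓ i) (ξ i t ω) (FedPBC.clientModel ℓ ξ A η s x₀ t i ω)
          | FedPBC.history ξ A t]
        =ᵐ[P] fun ω => ∇ (FedPBC.localObjective (ℓ i) (D i))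
          (FedPBC.clientModel ℓ ξ A η s x₀ t i ω))
    (h_variance : ∀ t < T, ∀ i x,
      Integrable (fun ω => ‖FedPBC.stochGrad (ℓ i) (ξ i t ω) x
        - ∇ (FedPBC.localObjective (ℓ i) (D i)) x‖ ^ 2) P ∧
      P[fun ω => ‖FedPBC.stochGrad (ℓ i) (ξ i t ω) x
          - ∇ (FedPBC.localObjective (ℓ i) (D i)) x‖ ^ 2 | FedPBC.history ξ A t]
        ≤ᵐ[P] fun _ => σ ^ 2)
    -- the global objective is bounded below
    (Fstar : ℝ) (hFstar : ∀ x, Fstar ≤ FedPBC.globalObjective ℓ D x)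
    -- bounded gradient dissimilarity
    (β ζ : ℝ)
    (h_dissim : ∀ x, (1 / (m : ℝ)) * ∑ i, ‖∇ (FedPBC.localObjective (ℓ i) (D i)) x
        - ∇ (FedPBC.globalObjective ℓ D) x‖ ^ 2
      ≤ β ^ 2 * ‖∇ (FedPBC.globalObjective ℓ D) x‖ ^ 2 + ζ ^ 2)
    -- condition on the learning rate
    (hη_le : η ≤ (1 - √(FedPBC.rho hm P A T)) /
      (108 * FedPBC.maxLip L ^ 2 * (s : ℝ) ^ 3 * (β ^ 2 + 1) *
        (1 + FedPBC.kappa L η s ^ 2 * FedPBC.maxLip L ^ 2))) :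
    (∀ t < T, Integrable (fun ω =>
      ‖∇ (FedPBC.globalObjective ℓ D) (FedPBC.avgModel ℓ ξ A η s x₀ t ω)‖ ^ 2) P) ∧
    (1 / (T : ℝ)) * ∑ t ∈ Finset.range T,
        ∫ ω, ‖∇ (FedPBC.globalObjective ℓ D) (FedPBC.avgModel ℓ ξ A η s x₀ t ω)‖ ^ 2 ∂P
      ≤ 6 * (FedPBC.globalObjective ℓ D x₀ - Fstar) / (η * s * T)
        + 54 * η * s * FedPBC.maxLip L *
          (FedPBC.kappa L η s ^ 2 * FedPBC.maxLip L ^ 2 + 1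
            + 1 / (1 - √(FedPBC.rho hm P A T))) * (σ ^ 2 + ζ ^ 2) := by
  have hm0 : 0 < m := by omega
  have hLle : ∀ i, (L i : ℝ) ≤ maxLip L := le_maxLip L
  have hL0 : 0 ≤ maxLip L := by linarith
  obtain ⟨K, hK⟩ : ∃ K : ℝ≥0, (K : ℝ) = maxLip L := ⟨⟨maxLip L, hL0⟩, rfl⟩
  have hLK : ∀ i, L i ≤ K := fun i => by
    rw [← NNReal.coe_le_coe, hK]; exact hLle i
  have hgm : ∀ i, Measurable fun p : EuclideanSpace ℝ (Fin d) × Ξ i => stochGrad (ℓ i) p.2 p.1 :=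
    fun i => measurable_stochGrad_uncurry (hℓ_meas i) (hℓ_diff i) (hℓ_lip i)
  have hFi : ∀ i, Differentiable ℝ (localObjective (ℓ i) (D i)) := fun i x =>
    (hasGradientAt_localObjective (hℓ_meas i) (hℓ_int i) (hℓ_diff i) (hℓ_lip i) x).differentiableAt
  have hFiK : ∀ i, LipschitzWith K (∇ (localObjective (ℓ i) (D i))) := fun i =>
    (lipschitzWith_gradient_localObjective (hℓ_meas i) (hℓ_int i) (hℓ_diff i)
      (hℓ_lip i)).weaken (hLK i)
  have hFH : ∀ x, ∇ (globalObjective ℓ D) x = mean fun i => ∇ (localObjective (ℓ i) (D i)) x :=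
    fun x => (hasGradientAt_globalObjective hFi x).gradient
  have hF : Differentiable ℝ (globalObjective ℓ D) := fun x =>
    (hasGradientAt_globalObjective hFi x).differentiableAt
  have hFK : LipschitzWith K (∇ (globalObjective ℓ D)) :=
    lipschitzWith_gradient_globalObjective hm0 hFi hFiK
  have hdis : ∀ x, spread (fun i => ∇ (localObjective (ℓ i) (D i)) x)
      ≤ β ^ 2 * ‖mean fun i => ∇ (localObjective (ℓ i) (D i)) x‖ ^ 2 + ζ ^ 2 := by
    intro x
    have h := h_dissim x
    rw [hFH] at h
    exact h
  -- square integrability of all the models and gradients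
  have h0 : ∀ t < T, ∀ i, MemLp (fun ω => stochGrad (ℓ i) (ξ i t ω) 0) 2 P := by
    intro t ht i
    have hmeas : Measurable fun ω => stochGrad (ℓ i) (ξ i t ω) 0 :=
      (measurable_stochGrad (hℓ_meas i) (hℓ_diff i) 0).comp (hξ i t)
    have h := (memLp_two_iff_integrable_sq_norm
      (hmeas.sub_const (∇ (localObjective (ℓ i) (D i)) 0)).aestronglyMeasurable).2
      (h_variance t ht i 0).1
    refine (h.add (memLp_const (∇ (localObjective (ℓ i) (D i)) 0))).congr_norm
      hmeas.aestronglyMeasurable (ae_of_all _ fun ω => ?_)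
    simp
  have hX : ∀ t ≤ T, ∀ i, MemLp (clientModel ℓ ξ A η s x₀ t i) 2 P :=
    fun t ht i => memLp_clientModel hη hξ hA hgm hℓ_lip h0 t ht i
  have hXm : ∀ t i, Measurable[history ξ A t] (clientModel ℓ ξ A η s x₀ t i) :=
    measurable_clientModel hgm
  have hg : ∀ t < T, ∀ i, MemLp (startGrad ℓ ξ A η s x₀ t i) 2 P :=
    fun t ht i => memLp_startGrad hξ hA hgm hℓ_lip (h0 t ht i) (hX t ht.le i)
  have hY : ∀ t < T, ∀ i, MemLp (localModel ℓ ξ A η s x₀ t i) 2 P :=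
    fun t ht i => memLp_localModel hη hξ hA hgm hℓ_lip (h0 t ht i) (hX t ht.le i)
  have hbar : ∀ t ≤ T, MemLp (avgModel ℓ ξ A η s x₀ t) 2 P := fun t ht => memLp_mean (hX t ht)
  have hgrad : ∀ t ≤ T, Integrable (fun ω =>
      ‖∇ (globalObjective ℓ D) (avgModel ℓ ξ A η s x₀ t ω)‖ ^ 2) P := fun t ht =>
    (memLp_comp_lipschitz hFK (hbar t ht)).integrable_norm_pow two_ne_zero
  refine ⟨fun t ht => hgrad t ht.le, ?_⟩
  -- variance of the stochastic gradients at the client models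
  have hvar : ∀ t < T, ∀ i, ∫ ω, ‖startGrad ℓ ξ A η s x₀ t i ω
      - ∇ (localObjective (ℓ i) (D i)) (clientModel ℓ ξ A η s x₀ t i ω)‖ ^ 2 ∂P ≤ σ ^ 2 := by
    intro t ht i
    have hinteg : Integrable (fun ω => ‖startGrad ℓ ξ A η s x₀ t i ω
        - ∇ (localObjective (ℓ i) (D i)) (clientModel ℓ ξ A η s x₀ t i ω)‖ ^ 2) P :=
      ((hg t ht i).sub (memLp_comp_lipschitz (hFiK i) (hX t ht.le i))).integrable_norm_pow
        two_ne_zero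
    -- The variance hypothesis concerns fixed points; the client model is random but measurable with
    -- respect to the history.
    have h := lintegral_comp_le_of_condExp_le (P := P) (history_le hξ hA t)
      (φ := fun x ω => ‖stochGrad (ℓ i) (ξ i t ω) x - ∇ (localObjective (ℓ i) (D i)) x‖ ^ 2)
      (fun ω => (((hℓ_lip i _).continuous.sub (hFiK i).continuous).norm.pow 2))
      (fun x ω => sq_nonneg _) (fun x => (h_variance t ht i x).1)
      (fun x => ((((measurable_stochGrad (hℓ_meas i) (hℓ_diff i) x).comp (hξ i t)).sub_const
        _).norm.pow_const 2))
      (fun x => (h_variance t ht i x).2) (hXm t i).stronglyMeasurable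
    rw [← ENNReal.ofReal_le_ofReal_iff (sq_nonneg σ),
      ofReal_integral_eq_lintegral_ofReal hinteg (ae_of_all _ fun ω => sq_nonneg _)]
    exact h
  -- the constants
  set κ := kappa L η s with hκdef
  set r := √(rho hm P A T) with hrdef
  set δ := drift L η s with hδdef
  have hκ : 0 ≤ κ := kappa_nonneg L hη.le s
  have hs1 : (1 : ℝ) ≤ s := by exact_mod_cast hs
  have hs0 : (0 : ℝ) < s := by linarith
  have hδ0 : 0 ≤ δ := by rw [hδdef, drift]; positivity
  have hδ : δ ≤ κ * ((s : ℝ) ^ 2 / 2) * η * maxLip L := by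
    have hch : (s.choose 2 : ℝ) ≤ (s : ℝ) ^ 2 / 2 := by
      rw [Nat.cast_choose_two]
      nlinarith
    rw [hδdef, drift]
    gcongr
  have hr0 : 0 ≤ r := Real.sqrt_nonneg _
  have hden : 0 < 108 * maxLip L ^ 2 * (s : ℝ) ^ 3 * (β ^ 2 + 1) * (1 + κ ^ 2 * maxLip L ^ 2) := by
    positivity
  have hηc := (le_div_iff₀ hden).1 hη_le
  -- The spectral gap is hidden in the learning rate condition: 1 − r is at least η times a positive
  -- denominator.
  have hr1 : r < 1 := by
    have := mul_pos hη hden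
    linarith
  have hlam : ∀ t < T, lambda2 hm (meanSqGossip_isHermitian P A t) ≤ r ^ 2 := by
    intro t ht
    have h1 : lambda2 hm (meanSqGossip_isHermitian P A t) ≤ rho hm P A T :=
      le_ciSup (f := fun t : Fin T => lambda2 hm (meanSqGossip_isHermitian P A t))
        (Set.finite_range _).bddAbove ⟨t, ht⟩
    -- No sign of ρ is needed: if ρ ≤ 0, then λ₂ ≤ 0 ≤ r².
    rcases le_total 0 (rho hm P A T) with h | h
    · rw [hrdef, Real.sq_sqrt h]; exact h1
    · exact (h1.trans h).trans (sq_nonneg r)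
  -- the three estimates for one round
  set a : ℕ → ℝ := fun t =>
    ∫ ω, ‖∇ (globalObjective ℓ D) (avgModel ℓ ξ A η s x₀ t ω)‖ ^ 2 ∂P with ha
  set v : ℕ → ℝ := fun t => ∫ ω, spread (fun i => clientModel ℓ ξ A η s x₀ t i ω) ∂P with hv
  set u : ℕ → ℝ := fun t => ∫ ω, avgSq (fun i => startGrad ℓ ξ A η s x₀ t i ω) ∂P with hu
  set f : ℕ → ℝ := fun t => ∫ ω, globalObjective ℓ D (avgModel ℓ ξ A η s x₀ t ω) ∂P with hf
  have hu0 : ∀ t, 0 ≤ u t := fun t => integral_nonneg fun ω => avgSq_nonneg _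
  have hv0 : ∀ t, 0 ≤ v t := fun t => integral_nonneg fun ω => spread_nonneg _
  have ha0 : ∀ t, 0 ≤ a t := fun t => integral_nonneg fun ω => sq_nonneg _
  have est_u : ∀ t < T, u t ≤ σ ^ 2 + 2 * maxLip L ^ 2 * v t + 2 * (β ^ 2 + 1) * a t
      + 2 * ζ ^ 2 := by
    intro t ht
    have h := integral_avgSq_le hm0 (history_le hξ hA t) hFiK hdis (hXm t) (hX t ht.le)
      (hg t ht) (h_unbiased t ht) (hvar t ht)
    simp only [← hFH, hK] at h
    exact h
  have est_f : ∀ t < T, f (t + 1) ≤ f t - 3 / 8 * (η * s) * a t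
      + η * s / 2 * maxLip L ^ 2 * v t
      + (2 * η / s * δ ^ 2 + maxLip L * η ^ 2 * (s + δ) ^ 2) * u t := by
    intro t ht
    have hnext := hbar (t + 1) ht
    have hsucc : avgModel ℓ ξ A η s x₀ (t + 1) = fun ω =>
        (mean fun i => clientModel ℓ ξ A η s x₀ t i ω)
          - η • mean fun i => roundGrad ℓ ξ A η s x₀ t i ω :=
      funext fun ω => avgModel_succ_eq_sub t ω
    rw [hsucc] at hnext
    have h := integral_descent hm0 (history_le hξ hA t) hF hFK hFiK hFH (hXm t) (hX t ht.le)
      (hg t ht) (h_unbiased t ht) hη hs0 (norm_roundGrad_sub_le hη hℓ_lip t)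
      (norm_roundGrad_le hη hℓ_lip t) hnext
    rw [hK] at h
    simp only [hf, hsucc]
    exact h
  have est_v : ∀ t < T, v (t + 1) ≤ r * v t + 1 / (1 - r) * (η ^ 2 * (s + δ) ^ 2) * u t := by
    intro t ht
    have hc : 0 < 1 - r := by linarith
    have h1 := integral_spread_succ_le hm hξ hA hgm (hA_indep t ht)
      ((hlam t ht).trans_lt (by nlinarith)) (hY t ht)
    have h2 : ∫ ω, r ^ 2 * spread (fun i => localModel ℓ ξ A η s x₀ t i ω) ∂P
        ≤ ∫ ω, (r * spread (fun i => clientModel ℓ ξ A η s x₀ t i ω)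
          + 1 / (1 - r) * (η ^ 2 * (s + δ) ^ 2) *
            avgSq (fun i => startGrad ℓ ξ A η s x₀ t i ω)) ∂P := by
      refine integral_mono ((integrable_spread (hY t ht)).const_mul _)
        (((integrable_spread (hX t ht.le)).const_mul _).add
          ((integrable_avgSq (hg t ht)).const_mul _)) fun ω => ?_
      simp only [localModel_eq]
      refine (sq_mul_spread_sub_le hm0 hr0 hr1 η _ _).trans ?_
      rw [mul_assoc (1 / (1 - r)), mul_assoc (η ^ 2)]
      gcongr
      exact avgSq_le_mul_avgSq fun i => norm_roundGrad_le hη hℓ_lip t i ω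
    rw [integral_const_mul, integral_add ((integrable_spread (hX t ht.le)).const_mul _)
      ((integrable_avgSq (hg t ht)).const_mul _), integral_const_mul, integral_const_mul] at h2
    refine (h1.trans ?_).trans h2
    exact mul_le_mul_of_nonneg_right (hlam t ht) (integral_nonneg fun ω => spread_nonneg _)
  -- summation over the rounds
  have hf0 : f 0 = globalObjective ℓ D x₀ := by
    have : ∀ ω, avgModel ℓ ξ A η s x₀ 0 ω = x₀ := by
      intro ω
      have hm' : (m : ℝ) ≠ 0 := by positivity
      simp [avgModel, clientModel, state, ← Nat.cast_smul_eq_nsmul ℝ, smul_smul, hm']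
    simp [hf, this]
  have hv00 : v 0 = 0 := by
    have : ∀ ω, spread (fun i => clientModel ℓ ξ A η s x₀ 0 i ω) = 0 := by
      intro ω
      have hm' : (m : ℝ) ≠ 0 := by positivity
      simp [spread, avgSq, mean, clientModel, state, ← Nat.cast_smul_eq_nsmul ℝ, smul_smul, hm']
    simp [hv, this]
  have hfT : Fstar ≤ f T := by
    have h := integral_mono (integrable_const Fstar)
      (integrable_comp_of_lipschitz_gradient hF hFK (hbar T le_rfl)) fun ω => hFstar _
    simpa using h
  have sum_u : ∑ t ∈ Finset.range T, u t ≤ T * (σ ^ 2 + 2 * ζ ^ 2)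
      + 2 * maxLip L ^ 2 * ∑ t ∈ Finset.range T, v t
      + 2 * (β ^ 2 + 1) * ∑ t ∈ Finset.range T, a t := by
    have h := Finset.sum_le_sum fun t ht => est_u t (Finset.mem_range.1 ht)
    refine h.trans_eq ?_
    simp only [Finset.sum_add_distrib, ← Finset.mul_sum, Finset.sum_const, Finset.card_range,
      nsmul_eq_mul]
    ring
  have sum_f : 0 ≤ globalObjective ℓ D x₀ - Fstar
      - 3 / 8 * (η * s) * ∑ t ∈ Finset.range T, a t
      + η * s / 2 * maxLip L ^ 2 * ∑ t ∈ Finset.range T, v t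
      + (2 * η / s * δ ^ 2 + maxLip L * η ^ 2 * (s + δ) ^ 2) * ∑ t ∈ Finset.range T, u t := by
    have h := Finset.sum_le_sum fun t ht => est_f t (Finset.mem_range.1 ht)
    simp only [Finset.sum_add_distrib, Finset.sum_sub_distrib, ← Finset.mul_sum] at h
    have htel := Finset.sum_range_sub f T
    rw [Finset.sum_sub_distrib] at htel
    linarith
  have sum_v := sum_spread_le hv00 hr0 hv0 (fun t => mul_nonneg (by
    have : 0 < 1 - r := by linarith
    positivity) (hu0 t)) est_v
  have hT0 : (0 : ℝ) < T := by exact_mod_cast hT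
  -- The accumulated noise is N = T(σ² + 2ζ²), which is at most 2M.
  have hfinal := sum_gradient_bound (M := T * (σ ^ 2 + ζ ^ 2)) hL hs1 hη
    (by linarith : 0 < 1 - r) (by linarith) (by nlinarith [sq_nonneg β] : 1 ≤ β ^ 2 + 1) hδ0 hδ hηc
    (Finset.sum_nonneg fun t _ => ha0 t) (Finset.sum_nonneg fun t _ => hu0 t)
    (sub_nonneg.2 (hFstar x₀)) (by positivity)
    (by nlinarith [mul_nonneg hT0.le (sq_nonneg σ)]) sum_u
    (sum_v.trans_eq (by ring)) sum_f
  rw [one_div_mul_eq_div, div_le_iff₀ hT0]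
  refine hfinal.trans_eq ?_
  field_simp
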